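/- **Cellular automaton transducers.** A cellular automaton transducer (CAT) is a system $M=\langle S,F,A,B,\#,\delta\rangle$ with a finite nonempty state set $S$, accepting states $F\subseteq S$, a nonempty set $A\subseteq S$ of input symbols, a finite set $B$ of output symbols, a boundary symbol $\#\notin S$, and a function $\delta:(S\cup\{\#\})\times S\times(S\cup\{\#\})\to S\times(B^*\cup\{\bot\})$, where $\bot$ means "no output". On input $w=a_1\cdots a_n\in A^+$ there are $n$ cells; at time $0$ cell $i$ is in state $a_i$ and its output register contains $\bot$. At each step every cell evaluates $\delta$ on the states of its left neighbour, of itself and of its right neighbour ($\#$ replaces a missing neighbour); the first component is its next state, and the second component is written to its output register if the register still contains $\bot$ (a register containing a word is never changed). The input is *accepted* if at some time the leftmost cell is in an accepting state. The transduction $T(M)$ is the set of all $(w,v)\in A^+\times B^*$ such that $w$ is accepted, at some time no register contains $\bot$, and $v$ is the concatenation of the register contents from left to right. **Iterative array transducers.** An iterative array transducer (IAT) is a system $M=\langle S,F,A,B,\rhd,s_0,\delta,\delta_0\rangle$ with finite sets $S$ (states), $F\subseteq S$ (accepting states), $A$ (input symbols), $B$ (output symbols), an end-of-input symbol $\rhd\notin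 A$, a quiescent state $s_0\in S$, a function $\delta:S^3\to S$ with $\delta(s_0,s_0,s_0)=s_0$, and a partial function $\delta_0:(A\cup\{\rhd\})\times S^2\to B^*\times S$. There are cells $0,1,2,\dots$, all in state $s_0$ at time $0$. In step $t=1,2,\dots$ cell $0$ (the communication cell) applies $\delta_0$ to the current input symbol (the $t$-th symbol of the input $w$ if $t\le|w|$, else $\rhd$), its own state and the state of cell $1$; this yields a (possibly empty) output word and its next state. Every other cell applies $\delta$ to the states of its left neighbour, of itself and of its right neighbour. $M$ halts when $\delta_0$ is undefined for the current configuration. The input is *accepted* if cell $0$ is in an accepting state at some time of the computation. $T(M)$ is the set of all pairs $(w,v)\in A^+\times B^*$ such that $w$ is accepted, $M$ halts on $w$, and $v$ is the total output emitted. **Families.** In both models, acceptance decides which inputs are transformed: we consider transducers $M$ for which the projection of $T(M)$ on the first components is the language of accepted nonempty inputs, that is, every accepted input $w\ne\lambda$ has an output. $M$ has time complexity $(t_i,t_o)$ if for all $(w,v)\in T(M)$ the input $w$ is accepted after at most $t_i(|w|)$ steps and the output is completed after at most $t_o(|w|)$ steps (for a CAT: no register contains $\bot$; for an IAT: $M$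 has halted). The families of transductions realized by CATs and IATs of time complexity $(t_i,t_o)$ are $\mathscr T(\mathrm{CAT}_{t_i,t_o})$ and $\mathscr T(\mathrm{IAT}_{t_i,t_o})$; all alphabets are finite subsets of a fixed infinite supply of symbols. Real time ($rt$) is the bound $n$ for CATs and $n+1$ for IATs; linear time ($lt$) means a bound $k\cdot n$ for some $k\in\mathbb Q$, $k\ge1$, which may depend on the transducer. **Corollary.** $\mathscr T(\mathrm{IAT}_{rt,rt})$ is strictly included in $\mathscr T(\mathrm{CAT}_{rt,rt})$, and $\mathscr T(\mathrm{IAT}_{rt,lt})$ is strictly included in $\mathscr T(\mathrm{CAT}_{rt,lt})$. -/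

import Mathlib

/-- A transduction over a supply `Γ` of symbols: a set of pairs (input word, output word). -/
abbrev Transduction (Γ : Type*) := Set (List Γ × List Γ)

/-- A transduction over finite alphabets `A, B ⊆ Γ`, read as a set of pairs of words over `Γ`. -/
def Transduction.ofAlphabets {Γ : Type*} {A B : Finset Γ} (T : Set (List A × List B)) :
    Transduction Γ :=
  (fun p => (p.1.map Subtype.val, p.2.map Subtype.val)) '' T

/-- The linear time bound `k · n`: a number of steps `t` satisfies `t ≤ ⌊k · n⌋` iff `t ≤ k · n`. -/
def linearTime (k : ℚ) (n : ℕ) : ℕ := ⌊k * (n : ℚ)⌋₊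

/-! ### Cellular automaton transducers -/

/-- A cellular automaton transducer with input alphabet `A` and output alphabet `B`.
In an argument of `δ`, `none` is the boundary symbol `#`; in the output component of its value,
`none` is the symbol `⊥` (no output) and `some u` is the emission of the word `u` (possibly
empty). -/
structure CAT (A B : Type*) where
  /-- cell states -/
  S : Type
  finite_S : Finite S
  /-- accepting states -/
  F : Set S
  /-- the inclusion of the input symbols into the states -/
  inp : A ↪ S
  /-- local transition function; arguments: left neighbour, cell itself, right neighbour -/
  δ : Option S → S → Option S → S × Option (List B)

namespace CAT

variable {A B : Type*} (M : CAT A B)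

/-- Configurations on `n` cells (cell `i + 1` has index `i`): the states of the cells and the
contents of their output registers (`none`: no output so far). -/
structure Config (n : ℕ) where
  state : Fin n → M.S
  out : Fin n → Option (List B)

/-- What a cell sees to its left: the boundary symbol (leftmost cell) or its neighbour's state. -/
def leftOf {n : ℕ} (c : Fin n → M.S) (i : Fin n) : Option M.S :=
  if i.val = 0 then none else some (c ⟨i.val - 1, by omega⟩)

/-- What a cell sees to its right: the boundary symbol (rightmost cell) or its neighbour's state. -/
def rightOf {n : ℕ} (c : Fin n → M.S) (i : Fin n) : Option M.S :=
  if h : i.val + 1 < n then some (c ⟨i.val + 1, h⟩) else none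

/-- The value of the local transition function at cell `i`. -/
def localStep {n : ℕ} (c : Fin n → M.S) (i : Fin n) : M.S × Option (List B) :=
  M.δ (M.leftOf c i) (c i) (M.rightOf c i)

/-- The global transition function; an output register that has been filled keeps its content. -/
def step {n : ℕ} (C : M.Config n) : M.Config n where
  state i := (M.localStep C.state i).1
  out i := match C.out i with
    | some u => some u
    | none => (M.localStep C.state i).2

/-- The initial configuration on input `w`. -/
def init (w : List A) : M.Config w.length where
  state i := M.inp (w.get i)
  out _ := none

/-- The configuration at time `t` on input `w`. -/
def config (w : List A) (t : ℕ) : M.Config w.length := (M.step)^[t] (M.init w)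

/-- At time `t` the leftmost cell is in an accepting state. -/
def AcceptsAt (w : List A) (t : ℕ) : Prop :=
  ∃ i : Fin w.length, i.val = 0 ∧ (M.config w t).state i ∈ M.F

/-- The input `w` is accepted. -/
def Accepts (w : List A) : Prop := ∃ t, M.AcceptsAt w t

/-- At time `t` all cells have emitted an output. -/
def CompleteAt (w : List A) (t : ℕ) : Prop := ∀ i, (M.config w t).out i ≠ none

/-- The transduction `T(M) ⊆ A⁺ × B*`. -/
def transduction : Set (List A × List B) :=
  {p | p.1 ≠ [] ∧ M.Accepts p.1 ∧
    ∃ (t : ℕ) (o : Fin p.1.length → List B),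
      (∀ i, (M.config p.1 t).out i = some (o i)) ∧ p.2 = (List.ofFn o).flatten}

/-- The projection `L(M)` of `T(M)` on the first components is the language accepted by the
underlying cellular automaton: the accepted nonempty inputs are exactly those that are
transformed. -/
def ProjectionIsAccepted : Prop :=
  Prod.fst '' M.transduction = {w | w ≠ [] ∧ M.Accepts w}

/-- `M` is of time complexity `(tin, tout)`. -/
def HasTime (tin tout : ℕ → ℕ) : Prop :=
  ∀ w v, (w, v) ∈ M.transduction →
    (∃ t ≤ tin w.length, M.AcceptsAt w t) ∧ (∃ t ≤ tout w.length, M.CompleteAt w t)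

end CAT

/-- The family `𝒯(CAT_{tin,tout})`; all alphabets are finite sets of symbols from `Γ`. -/
def CATFamily (Γ : Type*) (tin tout : ℕ → ℕ) : Set (Transduction Γ) :=
  {T | ∃ (A B : Finset Γ) (M : CAT A B), A.Nonempty ∧ M.ProjectionIsAccepted ∧
    M.HasTime tin tout ∧ T = Transduction.ofAlphabets M.transduction}

/-- Real time for cellular automaton transducers. -/
def CAT.realTime (n : ℕ) : ℕ := n

/-- The family `𝒯(CAT_{rt,rt})`. -/
def CATFamilyRtRt (Γ : Type*) : Set (Transduction Γ) :=
  CATFamily Γ CAT.realTime CAT.realTime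

/-- The family `𝒯(CAT_{rt,lt})`. -/
def CATFamilyRtLt (Γ : Type*) : Set (Transduction Γ) :=
  {T | ∃ k : ℚ, 1 ≤ k ∧ T ∈ CATFamily Γ CAT.realTime (linearTime k)}

/-! ### Iterative array transducers -/

/-- An iterative array transducer with input alphabet `A` and output alphabet `B`.
In the first argument of `δ₀`, `none` is the end-of-input symbol. The function `δ₀` is partial;
the value `none` means that it is undefined. -/
structure IAT (A B : Type*) where
  /-- cell states -/
  S : Type
  finite_S : Finite S
  /-- accepting states -/
  F : Set S
  /-- quiescent state -/
  s₀ : S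
  /-- transition function of the non-communication cells; arguments: left neighbour, cell itself,
  right neighbour -/
  δ : S → S → S → S
  δ_quiescent : δ s₀ s₀ s₀ = s₀
  /-- transition function of the communication cell; arguments: input symbol, cell itself,
  right neighbour -/
  δ₀ : Option A → S → S → Option (List B × S)

namespace IAT

variable {A B : Type*} (M : IAT A B)

/-- Configurations: the states of the cells (cell `0` is the communication cell) and the total
output emitted so far. -/
structure Config where
  state : ℕ → M.S
  out : List B

/-- The initial configuration. -/
def init : M.Config where
  state _ := M.s₀
  out := []

/-- The value of `δ₀` in configuration `C` when the symbol `a` is read. -/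
def comm (C : M.Config) (a : Option A) : Option (List B × M.S) :=
  M.δ₀ a (C.state 0) (C.state 1)

/-- The global transition function when the symbol `a` is read; undefined if `δ₀` is. -/
def step (C : M.Config) (a : Option A) : Option M.Config :=
  (M.comm C a).map fun r =>
    { state := fun i => match i with
        | 0 => r.2
        | j + 1 => M.δ (C.state j) (C.state (j + 1)) (C.state (j + 2))
      out := C.out ++ r.1 }

/-- The configuration at time `t` on input `w`, undefined if the computation halts earlier. In
the step from time `t` to time `t + 1` the communication cell reads the symbol `w[t]?`, that is,
the symbol number `t + 1` of `w`, or the end-of-input symbol if `w` has been consumed. -/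
def config (w : List A) : ℕ → Option M.Config
  | 0 => some M.init
  | t + 1 => (config w t).bind fun C => M.step C w[t]?

/-- At time `t` the communication cell is in an accepting state. -/
def AcceptsAt (w : List A) (t : ℕ) : Prop :=
  ∃ C, M.config w t = some C ∧ C.state 0 ∈ M.F

/-- The input `w` is accepted. -/
def Accepts (w : List A) : Prop := ∃ t, M.AcceptsAt w t

/-- On input `w` the computation halts at time `t` with total output `v`. -/
def HaltsAtWith (w : List A) (t : ℕ) (v : List B) : Prop :=
  ∃ C, M.config w t = some C ∧ M.comm C w[t]? = none ∧ C.out = v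

/-- The transduction `T(M)`, restricted to nonempty inputs (as languages are identified if they
differ at most by the empty word). -/
def transduction : Set (List A × List B) :=
  {p | p.1 ≠ [] ∧ M.Accepts p.1 ∧ ∃ t, M.HaltsAtWith p.1 t p.2}

/-- The projection `L(M)` of `T(M)` on the first components is the language accepted by the
underlying iterative array: the accepted nonempty inputs are exactly those that are
transformed. -/
def ProjectionIsAccepted : Prop :=
  Prod.fst '' M.transduction = {w | w ≠ [] ∧ M.Accepts w}

/-- `M` is of time complexity `(tin, tout)`. -/
def HasTime (tin tout : ℕ → ℕ) : Prop :=
  ∀ w v, (w, v) ∈ M.transduction →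
    (∃ t ≤ tin w.length, M.AcceptsAt w t) ∧ (∃ t ≤ tout w.length, M.HaltsAtWith w t v)

end IAT

/-- The family `𝒯(IAT_{tin,tout})`; all alphabets are finite sets of symbols from `Γ`. -/
def IATFamily (Γ : Type*) (tin tout : ℕ → ℕ) : Set (Transduction Γ) :=
  {T | ∃ (A B : Finset Γ) (M : IAT A B), M.ProjectionIsAccepted ∧
    M.HasTime tin tout ∧ T = Transduction.ofAlphabets M.transduction}

/-- Real time for iterative array transducers: `n` steps to read the input and one step to read
the end-of-input symbol. -/
def IAT.realTime (n : ℕ) : ℕ := n + 1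

/-- The family `𝒯(IAT_{rt,rt})`. -/
def IATFamilyRtRt (Γ : Type*) : Set (Transduction Γ) :=
  IATFamily Γ IAT.realTime IAT.realTime

/-- The family `𝒯(IAT_{rt,lt})`. -/
def IATFamilyRtLt (Γ : Type*) : Set (Transduction Γ) :=
  {T | ∃ k : ℚ, 1 ≤ k ∧ T ∈ IATFamily Γ IAT.realTime (linearTime k)}

/-! *Inclusion.* Number positions so that at time `T` the communication cell stands at position `T -
1` and cell `j` at `T - 1 - j`. In these coordinates the head moves right by one per step, and the
next entry at `D` depends only on the entries at `D`, `D - 1`, `D - 2` (`rowStep_row`). Position `D`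
is created by the transition reading symbol `D` and keeps its arguments, so the output lies along
the line in chronological order. A cellular automaton stores `k + 4` positions per cell while the
input shifts left one cell per step. The head enters a new cell every `k + 3` steps, so it meets the
input exactly on time if `k + 4` array steps are simulated in `k + 3` automaton steps: one step in
`k + 3` is doubled (`IsNbhd.nextRow_eq`). Acceptance travels left as a flag and arrives by time `n`
(`acc_of_hit`). A cell emits the output of its block when the block is full, or, in the real-time
case, when the end of the input becomes visible (`register_eq`, `completeAt_length`). The blocks of
`n` cells hold `(k + 4) * n` transitions, so a large `k` accommodates any linear output time.

*Strictness.* Only the accepted language matters; the separating outputs are empty. Separated blocks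
`x₁, …, x_r` followed by a final block `y` form a word with a match iff the reversal of `y` is some
`xᵢ` (`hasMatch_blockWord_append`). A cellular automaton decides this by dynamic programming over
subwords, peeling off both end letters (`endsMatch_cons_concat`). In a real-time iterative array,
while reading a last block of length `m` and the end symbol, the communication cell can be
influenced only by the `m + 2` leftmost states reached before, together with whether acceptance has
already occurred. These data take at most `2 * s ^ (m + 2)` values for `s` states, fewer than the `2
^ 2 ^ m` sets of binary words to be distinguished (`not_forall_accepts_iff_hasMatch`). -/

/-! ### Iterative arrays in reversed, moving coordinates. -/

/-- An iterative array with a total transition function; `α` is the type of the symbols read. -/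
structure IterArray (α : Type) where
  V : Type
  quiet : V
  cell : V → V → V → V
  cell_quiet : cell quiet quiet quiet = quiet
  head : α → V → V → V

namespace IterArray

variable {α : Type} (N : IterArray α) (a : ℕ → α)

/-- The state of cell `j` at time `t` when the stream `a` is read. -/
def diag : ℕ → ℕ → N.V
  | 0, _ => N.quiet
  | t + 1, 0 => N.head (a t) (diag t 0) (diag t 1)
  | t + 1, j + 1 => N.cell (diag t j) (diag t (j + 1)) (diag t (j + 2))

/-- The arguments of a transition of the communication cell. -/
abbrev Args := α × N.V × N.V

/-- The arguments of the transition of the communication cell from time `t` to time `t + 1`. -/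
def read (t : ℕ) : N.Args := (a t, N.diag a t 0, N.diag a t 1)

theorem diag_quiet : ∀ t j : ℕ, t ≤ j → N.diag a t j = N.quiet
  | 0, _, _ => rfl
  | t + 1, 0, h => by omega
  | t + 1, j + 1, h => by
      rw [diag, diag_quiet t j (by omega), diag_quiet t (j + 1) (by omega),
        diag_quiet t (j + 2) (by omega), N.cell_quiet]

/-- An entry of a reversed configuration: the state of a cell, together with the arguments of the
transition of the communication cell that created the entry. -/
abbrev Entry := Option (N.V × Option N.Args)

/-- The configuration at time `T`, reversed: the communication cell is at position `T - 1`. -/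
def row (T : ℕ) (D : ℤ) : N.Entry :=
  if D < T then
    some (N.diag a T (T - 1 - D).toNat, if 0 ≤ D then some (N.read a D.toNat) else none)
  else none

/-- The state in an entry. -/
def entryState (e : N.Entry) : N.V := e.elim N.quiet Prod.fst

/-- The arguments in an entry. -/
def entryArgs (e : N.Entry) : Option N.Args := e.bind Prod.snd

/-- One step of the array on reversed configurations. -/
def rowStep (s : α) (ρ : ℤ → N.Entry) (D : ℤ) : N.Entry :=
  match ρ D with
  | some (v, g) =>
      some (N.cell v (N.entryState (ρ (D - 1))) (N.entryState (ρ (D - 2))), g)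
  | none => (ρ (D - 1)).map fun e =>
      (N.head s e.1 (N.entryState (ρ (D - 2))), some (s, e.1, N.entryState (ρ (D - 2))))

theorem row_of_lt {T : ℕ} {D : ℤ} (h : D < T) : N.row a T D =
    some (N.diag a T (T - 1 - D).toNat, if 0 ≤ D then some (N.read a D.toNat) else none) :=
  if_pos h

theorem row_of_le {T : ℕ} {D : ℤ} (h : (T : ℤ) ≤ D) : N.row a T D = none :=
  if_neg (by omega)

theorem entryArgs_row {T D : ℕ} (h : D < T) : N.entryArgs (N.row a T D) = some (N.read a D) := by
  rw [row_of_lt _ _ (by exact_mod_cast h)]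
  simp [entryArgs]

theorem exists_of_entryArgs_row {T : ℕ} {D : ℤ} {g : N.Args}
    (h : N.entryArgs (N.row a T D) = some g) : ∃ t, g = N.read a t := by
  unfold row at h
  split_ifs at h <;> simp [entryArgs] at h
  exact ⟨_, h.symm⟩

theorem row_neg {T : ℕ} {D : ℤ} (h : D < 0) : N.row a T D = some (N.quiet, none) := by
  rw [row_of_lt _ _ (by omega), diag_quiet _ _ _ _ (by omega), if_neg (by omega)]

theorem rowStep_congr {s : α} {ρ ρ' : ℤ → N.Entry} {D D' : ℤ} (h0 : ρ D = ρ' D')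
    (h1 : ρ (D - 1) = ρ' (D' - 1)) (h2 : ρ (D - 2) = ρ' (D' - 2)) :
    N.rowStep s ρ D = N.rowStep s ρ' D' := by
  unfold rowStep
  rw [h0, h1, h2]

/-- One time step also shifts the origin, so position `D` passes from cell `j` to cell `j + 1`,
whose old neighbourhood `j`, `j + 1`, `j + 2` sits at `D`, `D - 1`, `D - 2`. Information thus flows
only to the right, and a symbol is needed only at the new position `D = T`. -/
theorem rowStep_row {s : α} {T : ℕ} {D : ℤ} (h : D = T → s = a T) :
    N.rowStep s (N.row a T) D = N.row a (T + 1) D := by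
  rcases lt_trichotomy D T with hD | hD | hD
  · obtain ⟨j, hj⟩ : ∃ j : ℕ, (T : ℤ) - 1 - D = j := ⟨(T - 1 - D).toNat, by omega⟩
    have e0 : ((T + 1 : ℕ) - 1 - D : ℤ).toNat = j + 1 := by omega
    have e1 : (T - 1 - (D - 1) : ℤ).toNat = j + 1 := by omega
    have e2 : (T - 1 - (D - 2) : ℤ).toNat = j + 2 := by omega
    have e3 : (T - 1 - D : ℤ).toNat = j := by omega
    rw [rowStep, row_of_lt _ _ hD, row_of_lt _ _ (show D - 1 < T by omega),
      row_of_lt _ _ (show D - 2 < T by omega), row_of_lt _ _ (show D < (T + 1 : ℕ) by omega)]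
    simp only [e0, e1, e2, e3, entryState, Option.elim_some]
    rfl
  · rw [rowStep, row_of_le _ _ (by omega), row_of_lt _ _ (show D - 1 < T by omega),
      row_of_lt _ _ (show D - 2 < T by omega), row_of_lt _ _ (show D < (T + 1 : ℕ) by omega),
      h hD]
    have e0 : ((T + 1 : ℕ) - 1 - D : ℤ).toNat = 0 := by omega
    have e1 : (T - 1 - (D - 1) : ℤ).toNat = 0 := by omega
    have e2 : (T - 1 - (D - 2) : ℤ).toNat = 1 := by omega
    have e3 : D.toNat = T := by omega
    have e4 : (0 : ℤ) ≤ D := by omega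
    simp only [e0, e1, e2, e3, e4, entryState, Option.elim_some, Option.map_some, if_true]
    rfl
  · rw [rowStep, row_of_le _ _ (by omega), row_of_le _ _ (show (T : ℤ) ≤ D - 1 by omega),
      row_of_le _ _ (show ((T + 1 : ℕ) : ℤ) ≤ D by omega)]
    rfl

end IterArray

/-! ### The simulation schedule and block arithmetic. -/

/-- The number of steps of an iterative array simulated after `t` steps: two steps are simulated
at once at every multiple of `k + 3`. -/
def schedule (k t : ℕ) : ℕ := t + (t + (k + 2)) / (k + 3)

theorem schedule_mul (k m : ℕ) : schedule k ((k + 3) * m) = (k + 4) * m := by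
  have h : ((k + 3) * m + (k + 2)) / (k + 3) = m := by
    rw [Nat.mul_add_div (by omega), Nat.div_eq_of_lt (by omega), add_zero]
  rw [schedule, h]
  ring

theorem schedule_mul_add {k m s : ℕ} (h1 : 1 ≤ s) (h2 : s ≤ k + 3) :
    schedule k ((k + 3) * m + s) = (k + 4) * m + s + 1 := by
  obtain ⟨s, rfl⟩ : ∃ s', s = s' + 1 := ⟨s - 1, by omega⟩
  have h : ((k + 3) * m + (s + 1) + (k + 2)) / (k + 3) = m + 1 := by
    rw [show (k + 3) * m + (s + 1) + (k + 2) = (k + 3) * (m + 1) + s by ring,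
      Nat.mul_add_div (by omega), Nat.div_eq_of_lt (by omega), add_zero]
  rw [schedule, h]
  ring

/-- The two regimes: the head is about to enter block `m` with a double step, or it is inside block
`m` and makes a single step. -/
theorem schedule_cases (k t : ℕ) :
    (∃ m, t = (k + 3) * m ∧ schedule k t = (k + 4) * m ∧
      schedule k (t + 1) = (k + 4) * m + 2) ∨
    ∃ m s, 1 ≤ s ∧ s ≤ k + 2 ∧ t = (k + 3) * m + s ∧ schedule k t = (k + 4) * m + s + 1 ∧
      schedule k (t + 1) = (k + 4) * m + s + 2 := by
  have h := Nat.div_add_mod t (k + 3)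
  have h' := Nat.mod_lt t (show 0 < k + 3 by omega)
  rcases Nat.eq_zero_or_pos (t % (k + 3)) with h0 | h0
  · left
    refine ⟨t / (k + 3), by omega, ?_, ?_⟩
    · conv_lhs => rw [← h, h0, add_zero, schedule_mul]
    · conv_lhs => rw [← h, h0, add_zero, schedule_mul_add le_rfl (by omega)]
  · right
    refine ⟨t / (k + 3), t % (k + 3), h0, by omega, h.symm, ?_, ?_⟩
    · conv_lhs => rw [← h, schedule_mul_add h0 (by omega)]
    · conv_lhs => rw [← h, add_assoc, schedule_mul_add (by omega) (by omega)]
      rfl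

theorem schedule_strictMono (k : ℕ) : StrictMono (schedule k) :=
  strictMono_nat_of_lt_succ fun t => by
    rcases schedule_cases k t with ⟨m, -, h1, h2⟩ | ⟨m, s, -, -, -, h1, h2⟩ <;> omega

/-- In block form, positions in the same block have the same block number. -/
theorem block_eq {r x m e f : ℕ} (he : e < r) (hf : f < r) (h : r * x + e = r * m + f) :
    x = m ∧ e = f := by
  rcases lt_trichotomy x m with h' | h' | h'
  · have := Nat.mul_le_mul_left r (show x + 1 ≤ m from h')
    rw [Nat.mul_add] at this
    omega
  · subst h'
    omega
  · have := Nat.mul_le_mul_left r (show m + 1 ≤ x from h')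
    rw [Nat.mul_add] at this
    omega

/-! ### The simulating automaton and the correctness of one step. -/

namespace IterArray

variable {α : Type} (N : IterArray α) (k : ℕ)

/-- The states of the cellular automaton simulating an iterative array. -/
@[ext]
structure PipeState where
  sym : α
  block : Fin (k + 4) → N.Entry
  clock : ZMod (k + 3)
  acc : Prop

theorem finite_pipeState [Finite α] [Finite N.V] : Finite (N.PipeState k) :=
  Finite.of_injective (fun s : N.PipeState k => (s.sym, s.block, s.clock, s.acc)) fun s s' h => by
    simp only [Prod.mk.injEq] at h
    exact PipeState.ext h.1 h.2.1 h.2.2.1 h.2.2.2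

variable {N k}

/-- The part of the reversed configuration that is visible from a cell, relative to the first
position stored in this cell. -/
def window (l : Option (N.PipeState k)) (c : N.PipeState k) (r : Option (N.PipeState k)) (i : ℤ) :
    N.Entry :=
  if 0 ≤ i then
    if h : i.toNat < k + 4 then c.block ⟨i.toNat, h⟩ else r.elim none fun s => s.block 0
  else l.elim (some (N.quiet, none)) fun s => s.block (Fin.ofNat (k + 4) (i + (k + 4)).toNat)

/-- The symbol to the right of a cell. -/
def rightSym (fin : α) (r : Option (N.PipeState k)) : α := r.elim fin PipeState.sym

open Classical in
/-- The part of the next reversed configuration that is computed by a cell. -/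
def nextRow (fin : α) (l : Option (N.PipeState k)) (c : N.PipeState k)
    (r : Option (N.PipeState k)) : ℤ → N.Entry :=
  N.rowStep (rightSym fin r)
    (if c.clock = 0 then N.rowStep c.sym (window l c r) else window l c r)

/-- An entry is marked if its arguments satisfy `hit`. -/
def Marked (hit : N.Args → Prop) (e : N.Entry) : Prop := ∃ g, N.entryArgs e = some g ∧ hit g

/-- The next state of a cell. -/
def pipeStep (fin : α) (hit : N.Args → Prop) (l : Option (N.PipeState k)) (c : N.PipeState k)
    (r : Option (N.PipeState k)) : N.PipeState k where
  sym := rightSym fin r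
  block e := nextRow fin l c r e
  clock := c.clock + 1
  acc := c.acc ∨ (∃ e : Fin (k + 4), Marked hit (nextRow fin l c r e)) ∨
    -- The first entry of the right neighbour's block is evaluated here as well: a mark there would
    -- otherwise reach the leftmost cell one step too late.
    ∃ s, r = some s ∧ (s.acc ∨ Marked hit (N.rowStep s.sym (window l c r) (k + 4 : ℕ)))

/-- The output word of an entry. -/
def entryOut {B : Type*} (out : N.Args → List B) (e : N.Entry) : List B :=
  (N.entryArgs e).elim [] out

open Classical in
/-- The output of a cell: the words of the entries of its block, as soon as the block is
complete; with `flush` set, also as soon as the end of the input is visible. -/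
noncomputable def pipeOut {B : Type*} (fin : α) (out : N.Args → List B) (flush : Prop)
    (l : Option (N.PipeState k)) (c : N.PipeState k) (r : Option (N.PipeState k)) :
    Option (List B) :=
  if nextRow fin l c r (k + 3 : ℕ) ≠ none ∨
      flush ∧ (c.sym = fin ∨ rightSym fin r = fin ∧ nextRow fin l c r 0 ≠ none) then
    some (List.ofFn fun e : Fin (k + 4) => entryOut out (nextRow fin l c r e)).flatten
  else none

/-- The state `c` is the correct state of cell `x` at time `t`, up to acceptance. -/
structure IsCell (a : ℕ → α) (t x : ℕ) (c : N.PipeState k) : Prop where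
  sym : c.sym = a (x + t)
  block (e : Fin (k + 4)) : c.block e = N.row a (schedule k t) (((k + 4) * x + e : ℕ) : ℤ)
  clock : c.clock = t

/-- The states `l`, `c`, `r` are the correct states of cell `x` and its neighbours at time `t`. -/
structure IsNbhd (fin : α) (a : ℕ → α) (t x : ℕ) (l : Option (N.PipeState k))
    (c : N.PipeState k) (r : Option (N.PipeState k)) : Prop where
  left_none : x = 0 → l = none
  left_some (y : ℕ) : x = y + 1 → ∃ s, l = some s ∧ IsCell a t y s
  cell : IsCell a t x c
  right : (r = none ∧ a (x + t + 1) = fin) ∨ ∃ s, r = some s ∧ IsCell a t (x + 1) s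

namespace IsNbhd

variable {fin : α} {a : ℕ → α} {t x : ℕ} {l : Option (N.PipeState k)}
    {c : N.PipeState k} {r : Option (N.PipeState k)} (h : IsNbhd fin a t x l c r)
include h

theorem rightSym_eq : rightSym fin r = a (x + t + 1) := by
  rcases h.right with ⟨rfl, h'⟩ | ⟨s, rfl, hs⟩
  · exact h'.symm
  · rw [rightSym, Option.elim_some, hs.sym, add_right_comm]

theorem window_eq {i : ℤ} (h1 : -(k + 4 : ℕ) ≤ i) (h2 : i < (k + 4 : ℕ)) :
    window l c r i = N.row a (schedule k t) (((k + 4) * x : ℕ) + i) := by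
  unfold window
  split_ifs with h3 h4
  · rw [h.cell.block]
    congr 1
    push_cast
    rw [Int.toNat_of_nonneg h3]
  · omega
  · rcases Nat.eq_zero_or_pos x with rfl | hx
    · rw [h.left_none rfl, Option.elim_none, row_neg]
      simpa using h3
    · obtain ⟨y, rfl⟩ : ∃ y, x = y + 1 := ⟨x - 1, by omega⟩
      obtain ⟨s, rfl, hs⟩ := h.left_some y rfl
      rw [Option.elim_some, hs.block]
      congr 1
      obtain ⟨e, he⟩ : ∃ e : ℕ, i + (k + 4) = e := ⟨(i + (k + 4)).toNat, by omega⟩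
      have : ((Fin.ofNat (k + 4) (i + (k + 4)).toNat : Fin (k + 4)) : ℕ) = e := by
        rw [he, Int.toNat_natCast, Fin.val_ofNat, Nat.mod_eq_of_lt (by omega)]
      rw [this]
      have : i = e - (k + 4) := by omega
      rw [this]
      push_cast
      ring

/-- Separate from `window_eq` because, without a right neighbour, the default `none` at this index
need not be the true entry. -/
theorem window_last {s : N.PipeState k} (hr : r = some s) :
    window l c r (k + 4 : ℕ) = N.row a (schedule k t) (((k + 4) * x : ℕ) + (k + 4 : ℕ)) := by
  rcases h.right with ⟨h', -⟩ | ⟨s', h', hs⟩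
  · simp [hr] at h'
  · subst h'
    unfold window
    rw [if_pos (by omega), dif_neg (by omega), Option.elim_some, hs.block]
    congr 1

theorem rowStep_window {s : α} {i : ℤ} (h1 : -(k + 2 : ℕ) ≤ i) (h2 : i < (k + 4 : ℕ))
    (hs : (((k + 4) * x : ℕ) : ℤ) + i = schedule k t → s = a (schedule k t)) :
    N.rowStep s (window l c r) i = N.row a (schedule k t + 1) (((k + 4) * x : ℕ) + i) := by
  rw [← N.rowStep_row a hs]
  apply N.rowStep_congr
  · exact h.window_eq (by omega) (by omega)
  · rw [h.window_eq (by omega) (by omega), add_sub_assoc]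
  · rw [h.window_eq (by omega) (by omega), add_sub_assoc]

/-- The required symbol is always at hand. At `t = (k + 3) * m`, cell `m` holds symbol `(k + 4) * m`
and its right neighbour the next one, which are the two symbols of the double step. Within the
block, each further symbol is held by the right neighbour at the moment of use. -/
theorem nextRow_eq {i : ℕ} (hi : i < k + 4) :
    nextRow fin l c r i = N.row a (schedule k (t + 1)) (((k + 4) * x + i : ℕ) : ℤ) := by
  unfold nextRow
  rw [h.rightSym_eq, h.cell.clock]
  rcases schedule_cases k t with ⟨m, ht, h1, h2⟩ | ⟨m, s, hs1, hs2, ht, h1, h2⟩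
  · have hc : ((t : ℕ) : ZMod (k + 3)) = 0 := by
      rw [ZMod.natCast_eq_zero_iff, ht]
      exact dvd_mul_right _ _
    -- The second of the two steps looks back two positions, so the first must be correct from `-2`
    -- on; it reads down to `-4`, which a left block of `k + 4` entries covers.
    have key : ∀ j : ℤ, -2 ≤ j → j < (k + 4 : ℕ) → N.rowStep c.sym (window l c r) j =
        N.row a (schedule k t + 1) (((k + 4) * x : ℕ) + j) := by
      intro j hj1 hj2
      refine h.rowStep_window (by omega) hj2 fun hj => ?_
      rw [h.cell.sym]
      rw [h1] at hj ⊢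
      congr 1
      rcases lt_or_ge j 0 with hj0 | hj0
      -- The head never creates an entry here: the new position is a multiple of `k + 4`, while this
      -- one lies strictly inside the left block.
      · obtain ⟨f, rfl⟩ : ∃ f : ℕ, j = -(f : ℤ) := ⟨(-j).toNat, by omega⟩
        obtain ⟨y, rfl⟩ : ∃ y, x = y + 1 := by
          rcases x with _ | y
          · have := Int.natCast_nonneg ((k + 4) * m)
            rw [Nat.mul_zero, Nat.cast_zero] at hj
            omega
          · exact ⟨y, rfl⟩
        have := block_eq (r := k + 4) (x := y) (m := m) (e := k + 4 - f) (f := 0)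
          (by omega) (by omega) (by rw [Nat.mul_add] at hj; omega)
        omega
      · obtain ⟨f, rfl⟩ : ∃ f : ℕ, j = f := ⟨j.toNat, by omega⟩
        have := block_eq (r := k + 4) (x := x) (m := m) (e := f) (f := 0)
          (by omega) (by omega) (by omega)
        rw [this.1, ht]
        ring
    rw [if_pos hc, show schedule k (t + 1) = schedule k t + 1 + 1 by omega,
      ← N.rowStep_row a (s := a (x + t + 1))]
    · apply N.rowStep_congr
      · rw [key _ (by omega) (by omega)]
        push_cast
        rfl
      · rw [key _ (by omega) (by omega)]
        push_cast
        rw [add_sub_assoc]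
      · rw [key _ (by omega) (by omega)]
        push_cast
        rw [add_sub_assoc]
    · intro hj
      rw [h1] at hj ⊢
      have := block_eq (r := k + 4) (x := x) (m := m) (e := i) (f := 1)
        (by omega) (by omega) (by omega)
      rw [this.1, ht]
      congr 1
      ring
  · have hc : ¬ ((t : ℕ) : ZMod (k + 3)) = 0 := by
      rw [ZMod.natCast_eq_zero_iff, ht, Nat.dvd_add_right (dvd_mul_right _ _)]
      exact fun hd => absurd (Nat.le_of_dvd (by omega) hd) (by omega)
    rw [if_neg hc, show schedule k (t + 1) = schedule k t + 1 by omega,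
      h.rowStep_window (by omega) (by omega)]
    · push_cast
      rfl
    · intro hj
      rw [h1] at hj ⊢
      have := block_eq (r := k + 4) (x := x) (m := m) (e := i) (f := s + 1)
        (by omega) (by omega) (by omega)
      rw [this.1, ht]
      congr 1
      ring

theorem isCell_pipeStep (hit : N.Args → Prop) :
    IsCell a (t + 1) x (pipeStep fin hit l c r) where
  sym := by rw [pipeStep, h.rightSym_eq, add_assoc]
  block e := h.nextRow_eq e.2
  clock := by
    show c.clock + 1 = _
    rw [h.cell.clock]
    push_cast
    rfl

theorem rowStep_last {s : N.PipeState k} (hr : r = some s) :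
    N.rowStep s.sym (window l c r) (k + 4 : ℕ) =
      N.row a (schedule k t + 1) (((k + 4) * (x + 1) : ℕ) : ℤ) := by
  have hsym : s.sym = a (x + t + 1) := by
    rw [← h.rightSym_eq, hr]
    rfl
  rw [← N.rowStep_row a (s := s.sym)]
  · apply N.rowStep_congr
    · rw [h.window_last hr]
      push_cast
      congr 1
    · rw [h.window_eq (by omega) (by omega)]
      push_cast
      congr 1
      ring
    · rw [h.window_eq (by omega) (by omega)]
      push_cast
      congr 1
      ring
  · intro hj
    rw [hsym]
    have hj' : (k + 4) * (x + 1) = schedule k t := by exact_mod_cast hj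
    rw [← hj']
    rcases schedule_cases k t with ⟨m, ht, h1, h2⟩ | ⟨m, s, hs1, hs2, ht, h1, h2⟩
    · have := block_eq (r := k + 4) (x := x + 1) (m := m) (e := 0) (f := 0)
        (by omega) (by omega) (by omega)
      rw [ht, ← this.1]
      congr 1
      ring
    · have := block_eq (r := k + 4) (x := x + 1) (m := m) (e := 0) (f := s + 1)
        (by omega) (by omega) (by omega)
      omega

end IsNbhd

end IterArray

/-! ### Runs and registers of cellular automaton transducers. -/

namespace CAT

variable {A B : Type*} (M : CAT A B)

theorem config_succ (w : List A) (t : ℕ) : M.config w (t + 1) = M.step (M.config w t) :=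
  Function.iterate_succ_apply' _ _ _

theorem state_succ (w : List A) (t : ℕ) (i : Fin w.length) :
    (M.config w (t + 1)).state i =
      (M.δ (M.leftOf (M.config w t).state i) ((M.config w t).state i)
        (M.rightOf (M.config w t).state i)).1 := by
  rw [config_succ]
  rfl

theorem out_succ_of_some {w : List A} {t : ℕ} {i : Fin w.length} {u : List B}
    (h : (M.config w t).out i = some u) : (M.config w (t + 1)).out i = some u := by
  rw [config_succ]
  simp only [step, h]

theorem out_succ_of_none {w : List A} {t : ℕ} {i : Fin w.length}
    (h : (M.config w t).out i = none) : (M.config w (t + 1)).out i =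
      (M.δ (M.leftOf (M.config w t).state i) ((M.config w t).state i)
        (M.rightOf (M.config w t).state i)).2 := by
  rw [config_succ]
  simp only [step, h]
  rfl

theorem out_ne_none_mono {w : List A} {t t' : ℕ} (htt' : t ≤ t') {i : Fin w.length}
    (h : (M.config w t).out i ≠ none) : (M.config w t').out i ≠ none := by
  induction htt' with
  | refl => exact h
  | step _ ih =>
    obtain ⟨u, hu⟩ := Option.ne_none_iff_exists'.1 ih
    rw [M.out_succ_of_some hu]
    exact Option.some_ne_none _

theorem out_succ_ne_none {w : List A} {t : ℕ} {i : Fin w.length}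
    (h : (M.δ (M.leftOf (M.config w t).state i) ((M.config w t).state i)
        (M.rightOf (M.config w t).state i)).2 ≠ none) : (M.config w (t + 1)).out i ≠ none := by
  rcases hu : (M.config w t).out i with _ | u
  · rwa [M.out_succ_of_none hu]
  · rw [M.out_succ_of_some hu]
    exact Option.some_ne_none _

/-- If every output of a cell has the right value, so has every register. -/
theorem out_eq {w : List A} {W : Fin w.length → List B}
    (h : ∀ t i u, (M.δ (M.leftOf (M.config w t).state i) ((M.config w t).state i)
        (M.rightOf (M.config w t).state i)).2 = some u → u = W i) (t : ℕ) (i : Fin w.length)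
    (u : List B) (hu : (M.config w t).out i = some u) : u = W i := by
  induction t with
  | zero => exact absurd hu (by simp [config, init])
  | succ t ih =>
    rcases hv : (M.config w t).out i with _ | v
    · rw [M.out_succ_of_none hv] at hu
      exact h t i u hu
    · rw [M.out_succ_of_some hv] at hu
      exact ih (hv.trans hu)

end CAT

/-- The stream of codes of the symbols of `w`, continued by an end symbol. -/
def List.codeStream {A : Type*} {α : Type} (code : A → α) (fin : α) (w : List A) (t : ℕ) : α :=
  (w[t]?).elim fin code

theorem List.codeStream_eq_fin_iff {A : Type*} {α : Type} {code : A → α} {fin : α} {w : List A}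
    (hfin : ∀ x, code x ≠ fin) {t : ℕ} : w.codeStream code fin t = fin ↔ w.length ≤ t := by
  rw [List.codeStream, ← List.getElem?_eq_none_iff]
  rcases w[t]? with _ | x
  · simp
  · simp [hfin]

/-! ### Acceptance and output of the simulation. -/

namespace IterArray

open CAT

variable {α : Type} (N : IterArray α) (k : ℕ) {A B : Type*} (code : A ↪ α) (fin : α)
  (hit : N.Args → Prop) (out : N.Args → List B) (flush : Prop)

/-- The cellular automaton transducer simulating an iterative array. -/
noncomputable def toCAT [Finite α] [Finite N.V] : CAT A B where
  S := N.PipeState k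
  finite_S := N.finite_pipeState k
  F := {s | s.acc}
  inp := ⟨fun x => ⟨code x, fun _ => none, 0, False⟩, fun _ _ h =>
    code.injective (congrArg PipeState.sym h)⟩
  δ l c r := (pipeStep fin hit l c r, pipeOut fin out flush l c r)

/-- The output of cell `x`. -/
def blockOut (a : ℕ → α) (x : ℕ) : List B :=
  (List.ofFn fun e : Fin (k + 4) => out (N.read a ((k + 4) * x + e))).flatten

theorem entryOut_row {a : ℕ → α} {T D : ℕ} (h : T ≤ D → out (N.read a D) = []) :
    entryOut out (N.row a T D) = out (N.read a D) := by
  rcases lt_or_ge D T with hD | hD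
  · rw [entryOut, N.entryArgs_row _ hD, Option.elim_some]
  · rw [N.row_of_le _ (by exact_mod_cast hD), h hD]
    rfl

/-- Blocks tile consecutive intervals of transitions, so left-to-right order of registers is
chronological order of output. -/
theorem flatten_blockOut (a : ℕ → α) (n : ℕ) :
    (List.ofFn fun i : Fin n => N.blockOut k out a i).flatten =
      ((List.range ((k + 4) * n)).map fun D => out (N.read a D)).flatten := by
  induction n with
  | zero => simp
  | succ n ih =>
    rw [List.ofFn_succ', List.concat_eq_append, List.flatten_append]
    simp only [Fin.val_castSucc, Fin.val_last]
    rw [ih, Nat.mul_succ, List.range_add, List.map_append, List.flatten_append]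
    congr 1
    rw [List.flatten_singleton, blockOut, List.map_map]
    congr 1
    rw [List.ofFn_eq_map, ← List.map_coe_finRange_eq_range, List.map_map]
    rfl

variable [Finite α] [Finite N.V] {w : List A}

local notation "𝓜" => N.toCAT k code fin hit out flush

local notation "𝓪" => List.codeStream code fin w

theorem isNbhd_of_forall {t : ℕ} (h : ∀ i, IsCell 𝓪 t i.val ((CAT.config 𝓜 w t).state i))
    (i : Fin w.length) : IsNbhd fin 𝓪 t i.val (CAT.leftOf 𝓜 (CAT.config 𝓜 w t).state i)
      ((CAT.config 𝓜 w t).state i) (CAT.rightOf 𝓜 (CAT.config 𝓜 w t).state i) where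
  left_none h0 := if_pos h0
  left_some y hy := by
    refine ⟨_, if_neg (by omega), ?_⟩
    obtain rfl : y = i.val - 1 := by omega
    exact h ⟨i.val - 1, by omega⟩
  cell := h i
  right := by
    by_cases hi : i.val + 1 < w.length
    · exact Or.inr ⟨_, dif_pos hi, h ⟨i.val + 1, hi⟩⟩
    · refine Or.inl ⟨dif_neg hi, ?_⟩
      rw [List.codeStream, List.getElem?_eq_none (by omega), Option.elim_none]

theorem isCell_config (t : ℕ) (i : Fin w.length) :
    IsCell 𝓪 t i.val ((CAT.config 𝓜 w t).state i) := by
  induction t generalizing i with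
  | zero =>
    refine ⟨?_, fun e => ?_, ?_⟩
    · show code (w.get i) = _
      simp [List.codeStream]
    · rw [row_of_le]
      · rfl
      · have : schedule k 0 = 0 := schedule_mul k 0
        rw [this]
        omega
    · exact Nat.cast_zero.symm
  | succ t ih =>
    rw [CAT.state_succ]
    exact (N.isNbhd_of_forall k code fin hit out flush ih i).isCell_pipeStep hit

theorem isNbhd_config (t : ℕ) (i : Fin w.length) :
    IsNbhd fin 𝓪 t i.val (CAT.leftOf 𝓜 (CAT.config 𝓜 w t).state i)
      ((CAT.config 𝓜 w t).state i) (CAT.rightOf 𝓜 (CAT.config 𝓜 w t).state i) :=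
  N.isNbhd_of_forall k code fin hit out flush (N.isCell_config k code fin hit out flush t) i

/-- Soundness: a flag originates in a marked entry, and the arguments stored in an entry always come
from an actual transition. -/
theorem hit_of_acc (t : ℕ) (i : Fin w.length) (h : PipeState.acc ((CAT.config 𝓜 w t).state i)) :
    ∃ D, hit (N.read 𝓪 D) := by
  induction t generalizing i with
  | zero => exact h.elim
  | succ t ih =>
    have hn := N.isNbhd_config k code fin hit out flush t i
    rw [CAT.state_succ] at h
    rcases h with h | ⟨e, g, hg, hh⟩ | ⟨s, hs, h | ⟨g, hg, hh⟩⟩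
    · exact ih i h
    · rw [hn.nextRow_eq e.2] at hg
      obtain ⟨D, rfl⟩ := N.exists_of_entryArgs_row _ hg
      exact ⟨D, hh⟩
    · unfold CAT.rightOf at hs
      split_ifs at hs
      obtain rfl := Option.some.inj hs
      exact ih _ h
    · rw [hn.rowStep_last hs] at hg
      obtain ⟨D, rfl⟩ := N.exists_of_entryArgs_row _ hg
      exact ⟨D, hh⟩

theorem acc_succ {t : ℕ} {i : Fin w.length} (h : PipeState.acc ((CAT.config 𝓜 w t).state i)) :
    PipeState.acc ((CAT.config 𝓜 w (t + 1)).state i) := by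
  rw [CAT.state_succ]
  exact Or.inl h

theorem acc_mono {t t' : ℕ} (htt' : t ≤ t') {i : Fin w.length}
    (h : PipeState.acc ((CAT.config 𝓜 w t).state i)) :
    PipeState.acc ((CAT.config 𝓜 w t').state i) := by
  induction htt' with
  | refl => exact h
  | step _ ih => exact N.acc_succ k code fin hit out flush ih

theorem acc_left {t x : ℕ} (hx : x < w.length)
    (h : PipeState.acc ((CAT.config 𝓜 w t).state ⟨x, hx⟩)) :
    PipeState.acc ((CAT.config 𝓜 w (t + x)).state ⟨0, by omega⟩) := by
  induction x generalizing t with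
  | zero => exact h
  | succ x ih =>
    rw [← add_assoc, add_right_comm]
    refine ih (by omega) ?_
    rw [CAT.state_succ]
    exact Or.inr (Or.inr ⟨_, dif_pos hx, Or.inl h⟩)

/-- Write `D = (k + 4) * m + e`. The flag for transition `D` is raised at about time `(k + 3) * m +
e` in cell `m` and needs `m` steps to reach the left end, which makes `D ≤ n` in total. -/
theorem acc_of_hit {D : ℕ} (hD : D ≤ w.length) (hw : w ≠ []) (h : hit (N.read 𝓪 D)) :
    PipeState.acc ((CAT.config 𝓜 w w.length).state ⟨0, List.length_pos_of_ne_nil hw⟩) := by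
  have hn := List.length_pos_of_ne_nil hw
  suffices ∃ t x, ∃ hx : x < w.length, t + x ≤ w.length ∧
      PipeState.acc ((CAT.config 𝓜 w t).state ⟨x, hx⟩) by
    obtain ⟨t, x, hx, htx, h⟩ := this
    exact N.acc_mono k code fin hit out flush htx (N.acc_left k code fin hit out flush hx h)
  have hdm := Nat.div_add_mod D (k + 4)
  have hlt := Nat.mod_lt D (show 0 < k + 4 by omega)
  set m := D / (k + 4)
  set e := D % (k + 4)
  have hmul : (k + 4) * m = (k + 3) * m + m := by ring
  have h3 : 3 * m ≤ (k + 3) * m := Nat.mul_le_mul_right _ (by omega)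
  by_cases hc : e = 0 ∧ m ≠ 0
  -- At the start of a block the entry appears at `(k + 3) * m + 1`, one step over budget from cell
  -- `m`; detection by cell `m - 1` saves that step.
  · obtain ⟨x, hx⟩ := Nat.exists_eq_succ_of_ne_zero hc.2
    have hx' : x + 1 < w.length := by omega
    refine ⟨(k + 3) * m + 1, x, by omega, by omega, ?_⟩
    have hn := N.isNbhd_config k code fin hit out flush ((k + 3) * m)
      (⟨x, by omega⟩ : Fin w.length)
    rw [CAT.state_succ]
    refine Or.inr (Or.inr ⟨_, dif_pos hx', Or.inr ⟨_, ?_, h⟩⟩)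
    rw [hn.rowStep_last (dif_pos hx')]
    have : (k + 4) * (x + 1) = D := by rw [show x + 1 = m from hx.symm]; omega
    simp only [this]
    apply N.entryArgs_row
    rw [schedule_mul]
    omega
  · have hm : m < w.length := by omega
    -- For `e ≥ 1` the choice `s = e - 1` gives arrival time exactly `D`; for `D = 0` the arrival
    -- time is `1`, which is within bounds as the input is nonempty.
    obtain ⟨s, hs1, hs2, hs3⟩ : ∃ s, s ≤ k + 2 ∧ e ≤ s + 1 ∧ (k + 3) * m + s + 1 + m ≤ w.length := by
      rcases Nat.eq_zero_or_pos e with he | he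
      · have hm0 : m = 0 := by omega
        exact ⟨0, by omega, by omega, by rw [hm0]; omega⟩
      · exact ⟨e - 1, by omega, by omega, by omega⟩
    refine ⟨(k + 3) * m + s + 1, m, hm, hs3, ?_⟩
    have hn := N.isNbhd_config k code fin hit out flush ((k + 3) * m + s)
      (⟨m, by omega⟩ : Fin w.length)
    rw [CAT.state_succ]
    refine Or.inr (Or.inl ⟨⟨e, hlt⟩, _, ?_, h⟩)
    rw [hn.nextRow_eq hlt]
    simp only [hdm]
    apply N.entryArgs_row
    rw [add_assoc, schedule_mul_add (by omega) (by omega)]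
    omega

theorem acceptsAt_length {D : ℕ} (hD : D ≤ w.length) (hw : w ≠ []) (h : hit (N.read 𝓪 D)) :
    CAT.AcceptsAt 𝓜 w w.length :=
  ⟨_, rfl, N.acc_of_hit k code fin hit out flush hD hw h⟩

theorem hit_of_accepts (h : CAT.Accepts 𝓜 w) : ∃ D, hit (N.read 𝓪 D) := by
  obtain ⟨t, i, -, h⟩ := h
  exact N.hit_of_acc k code fin hit out flush t i h

/-- A full block gives the right word at once. When flushing a partial block, either the head is
still to the left, with time plus cell index at least `n`, or it is inside, with the end symbol
visible at the cell or to its right. In both cases the schedule shows that every missing transition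
has index at least `n + 1`, hence empty output. -/
theorem register_eq (hfin : ∀ x, code x ≠ fin)
    (hout : flush → ∀ D, w.length + 1 ≤ D → out (N.read 𝓪 D) = []) (t : ℕ) (i : Fin w.length)
    (u : List B) (hu : (CAT.config 𝓜 w t).out i = some u) :
    u = N.blockOut k out 𝓪 i := by
  refine CAT.out_eq 𝓜 (W := fun i => N.blockOut k out 𝓪 i) (fun t i u h => ?_) t i u hu
  have hn := N.isNbhd_config k code fin hit out flush t i
  change pipeOut _ _ _ _ _ _ = _ at h
  unfold pipeOut at h
  split_ifs at h with hc
  obtain rfl := Option.some.inj h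
  unfold blockOut
  congr 2
  funext e
  rw [hn.nextRow_eq e.2]
  refine N.entryOut_row out fun hTD => ?_
  have he := e.2
  rw [hn.nextRow_eq (show k + 3 < k + 4 by omega),
    show (0 : ℤ) = ((0 : ℕ) : ℤ) from rfl, hn.nextRow_eq (show 0 < k + 4 by omega)] at hc
  rcases hc with hc | ⟨hf, hc⟩
  · exact absurd (N.row_of_le _ (Nat.cast_le.2 (by omega))) hc
  apply hout hf
  by_cases hc0 : N.row 𝓪 (schedule k (t + 1)) (((k + 4) * i.val + 0 : ℕ) : ℤ) = none
  · have hc' := hc.resolve_right fun h => h.2 hc0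
    rw [hn.cell.sym, List.codeStream_eq_fin_iff hfin] at hc'
    have hT : schedule k (t + 1) ≤ (k + 4) * i.val := by
      by_contra hlt
      rw [N.row_of_lt _ (Nat.cast_lt.2 (by omega))] at hc0
      exact absurd hc0 (Option.some_ne_none _)
    rw [← schedule_mul] at hT
    have := (schedule_strictMono k).le_iff_le.1 hT
    have : (k + 4) * i.val = (k + 3) * i.val + i.val := by ring
    omega
  · have hT : (k + 4) * i.val < schedule k (t + 1) := by
      by_contra hlt
      exact hc0 (N.row_of_le _ (Nat.cast_le.2 (by omega)))
    have hfin' : w.length ≤ i.val + t + 1 := by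
      rcases hc with hc | hc
      · rw [hn.cell.sym, List.codeStream_eq_fin_iff hfin] at hc
        omega
      · rw [hn.rightSym_eq, List.codeStream_eq_fin_iff hfin] at hc
        exact hc.1
    rcases schedule_cases k (t + 1) with ⟨m, h1, h2, -⟩ | ⟨m, s, hs1, hs2, h1, h2, -⟩
    · obtain ⟨d, hd⟩ : ∃ d, (k + 4) * m = (k + 4) * i.val + d := ⟨(k + 4) * m - (k + 4) * i.val,
        by omega⟩
      have := block_eq (r := k + 4) (x := i.val) (m := m) (e := d) (f := 0)
        (by omega) (by omega) (by omega)
      omega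
    · obtain ⟨d, hd⟩ : ∃ d, (k + 4) * m + s + 1 = (k + 4) * i.val + d :=
        ⟨(k + 4) * m + s + 1 - (k + 4) * i.val, by omega⟩
      have := block_eq (r := k + 4) (x := i.val) (m := m) (e := d) (f := s + 1)
        (by omega) (by omega) (by omega)
      have hm := this.1
      have : (k + 4) * i.val = (k + 3) * i.val + i.val := by ring
      rw [← hm] at h1
      omega

theorem completeAt_mul : CAT.CompleteAt 𝓜 w ((k + 3) * w.length) := by
  intro i
  have hi : (k + 3) * (i.val + 1) ≤ (k + 3) * w.length := Nat.mul_le_mul_left _ i.2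
  refine CAT.out_ne_none_mono 𝓜 hi ?_
  rw [Nat.mul_add, mul_one, show (k + 3) * i.val + (k + 3) = (k + 3) * i.val + (k + 2) + 1 by rfl]
  apply CAT.out_succ_ne_none
  have hn := N.isNbhd_config k code fin hit out flush ((k + 3) * i.val + (k + 2)) i
  change pipeOut _ _ _ _ _ _ ≠ _
  unfold pipeOut
  rw [if_pos]
  · exact Option.some_ne_none _
  · left
    rw [hn.nextRow_eq (by omega), N.row_of_lt]
    · exact Option.some_ne_none _
    · rw [add_assoc, schedule_mul_add (by omega) (by omega)]
      push_cast
      omega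

/-- The end symbol reaches cell `i ≥ 1` at time `n - i`, so its register is filled by `n - i + 1`.
Cell `0` would be one step late; it reacts to the end symbol on its right. -/
theorem completeAt_length (hf : flush) : CAT.CompleteAt 𝓜 w w.length := by
  intro i
  obtain ⟨n, hn⟩ : ∃ n, w.length = n + 1 := ⟨w.length - 1, by have := i.2; omega⟩
  have hlast : w.length ≤ n + 1 := hn.le
  rcases Nat.eq_zero_or_pos i.val with hi | hi
  · have h := N.isNbhd_config k code fin hit out flush n i
    refine CAT.out_ne_none_mono 𝓜 hn.ge ?_
    apply CAT.out_succ_ne_none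
    change pipeOut _ _ _ _ _ _ ≠ _
    unfold pipeOut
    rw [if_pos]
    · exact Option.some_ne_none _
    · refine Or.inr ⟨hf, Or.inr ⟨?_, ?_⟩⟩
      · rw [h.rightSym_eq, List.codeStream, List.getElem?_eq_none (by omega), Option.elim_none]
      · have := h.nextRow_eq (show 0 < k + 4 by omega)
        rw [Nat.cast_zero] at this
        rw [this, N.row_of_lt]
        · exact Option.some_ne_none _
        · rw [hi, schedule]
          exact Nat.cast_lt.2 (Nat.add_pos_left n.succ_pos _)
  · have := i.2
    have h := N.isNbhd_config k code fin hit out flush (w.length - i.val) i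
    refine CAT.out_ne_none_mono 𝓜 (show w.length - i.val + 1 ≤ w.length by omega) ?_
    apply CAT.out_succ_ne_none
    change pipeOut _ _ _ _ _ _ ≠ _
    unfold pipeOut
    rw [if_pos]
    · exact Option.some_ne_none _
    · refine Or.inr ⟨hf, Or.inl ?_⟩
      rw [h.cell.sym, List.codeStream, List.getElem?_eq_none (by omega), Option.elim_none]

end IterArray

/-! ### Simulation of iterative array transducers. -/

namespace IAT

open IterArray

variable {A B : Type*} (M : IAT A B) {m : ℕ} (σ : A ≃ Fin m)

/-- The value of the partial transition function of the communication cell on coded symbols, where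
`none` is the state after halting. -/
def codedComm (x : Option (Fin m)) (s r : Option M.S) : Option (List B × M.S) :=
  s.bind fun s => M.δ₀ (x.map σ.symm) s (r.getD M.s₀)

/-- An iterative array transducer, with its output ignored and its transition function made
total. -/
def toIterArray : IterArray (Option (Fin m)) where
  V := Option M.S
  quiet := some M.s₀
  cell l s r := some (M.δ (l.getD M.s₀) (s.getD M.s₀) (r.getD M.s₀))
  cell_quiet := congrArg some M.δ_quiescent
  head x s r := (M.codedComm σ x s r).map Prod.snd

/-- The embedding of the input symbols into the symbols read by `toIterArray`. -/
def code : A ↪ Option (Fin m) := σ.toEmbedding.trans Function.Embedding.some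

/-- The stream of symbols read on input `w`. -/
def stream (w : List A) : ℕ → Option (Fin m) := w.codeStream (code σ) none

/-- The output emitted by a transition of the communication cell. -/
def argsOut (g : (M.toIterArray σ).Args) : List B :=
  (M.codedComm σ g.1 g.2.1 g.2.2).elim [] Prod.fst

/-- The communication cell is in an accepting state before or after a transition. -/
def ArgsHit (g : (M.toIterArray σ).Args) : Prop :=
  (∃ s ∈ M.F, g.2.1 = some s) ∨ ∃ s ∈ M.F, (M.codedComm σ g.1 g.2.1 g.2.2).map Prod.snd = some s

theorem stream_map_symm (w : List A) (t : ℕ) : (stream σ w t).map σ.symm = w[t]? := by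
  unfold stream List.codeStream
  rcases w[t]? with _ | x
  · rfl
  · simp [code]

local notation "𝓝𝓝" => toIterArray M σ

/-- The total output until time `t`. -/
def outUntil (w : List A) (t : ℕ) : List B :=
  ((List.range t).map fun D => M.argsOut σ (IterArray.read 𝓝𝓝 (stream σ w) D)).flatten

theorem codedComm_read {w : List A} {t : ℕ} {C : M.Config}
    (h : ∀ j, IterArray.diag 𝓝𝓝 (stream σ w) t j = some (C.state j)) :
    M.codedComm σ (stream σ w t) (IterArray.diag 𝓝𝓝 (stream σ w) t 0)
      (IterArray.diag 𝓝𝓝 (stream σ w) t 1) = M.comm C w[t]? := by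
  rw [h, h, codedComm, Option.bind_some, stream_map_symm]
  rfl

theorem argsOut_read (w : List A) (t : ℕ) : M.argsOut σ (IterArray.read 𝓝𝓝 (stream σ w) t) =
    (M.codedComm σ (stream σ w t) (IterArray.diag 𝓝𝓝 (stream σ w) t 0)
      (IterArray.diag 𝓝𝓝 (stream σ w) t 1)).elim [] Prod.fst := rfl

/-- Halting becomes an absorbing `none` in cell `0`. After it, nothing is claimed about the other
cells of the totalized array. -/
theorem config_spec (w : List A) (t : ℕ) :
    (M.config w t = none ∧ IterArray.diag 𝓝𝓝 (stream σ w) t 0 = none) ∨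
    ∃ C, M.config w t = some C ∧
      (∀ j, IterArray.diag 𝓝𝓝 (stream σ w) t j = some (C.state j)) ∧
      C.out = M.outUntil σ w t := by
  induction t with
  | zero => exact Or.inr ⟨M.init, rfl, fun _ => rfl, rfl⟩
  | succ t ih =>
    rcases ih with ⟨h1, h2⟩ | ⟨C, h1, h2, h3⟩
    · refine Or.inl ⟨by rw [config, h1]; rfl, ?_⟩
      change Option.map _ (M.codedComm σ _ _ _) = _
      rw [h2]
      rfl
    · have hc := M.codedComm_read σ h2
      rcases hr : M.comm C w[t]? with _ | ⟨u, s⟩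
      · refine Or.inl ⟨by rw [config, h1, Option.bind_some, step, hr]; rfl, ?_⟩
        change Option.map _ (M.codedComm σ _ _ _) = _
        rw [hc, hr]
        rfl
      · refine Or.inr ⟨_, by rw [config, h1, Option.bind_some, step, hr]; rfl, ?_, ?_⟩
        · rintro (_ | j)
          · change Option.map _ (M.codedComm σ _ _ _) = _
            rw [hc, hr]
            rfl
          · change some (M.δ (Option.getD _ _) (Option.getD _ _) (Option.getD _ _)) = _
            rw [h2, h2, h2]
            rfl
        · rw [outUntil, List.range_succ, List.map_append, List.flatten_append]
          change C.out ++ u = _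
          rw [h3]
          congr 1
          change u = _ ++ []
          rw [List.append_nil]
          change u = M.argsOut σ (IterArray.read 𝓝𝓝 (stream σ w) t)
          rw [argsOut_read, hc, hr]
          rfl

theorem acceptsAt_iff (w : List A) (t : ℕ) :
    M.AcceptsAt w t ↔ ∃ s ∈ M.F, IterArray.diag 𝓝𝓝 (stream σ w) t 0 = some s := by
  unfold AcceptsAt
  rcases M.config_spec σ w t with ⟨h1, h2⟩ | ⟨C, h1, h2, -⟩
  · rw [h1, h2]
    simp
  · rw [h1, h2]
    constructor
    · rintro ⟨C', h, hF⟩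
      cases h
      exact ⟨_, hF, rfl⟩
    · rintro ⟨s, hs, h⟩
      obtain rfl : C.state 0 = s := Option.some.inj h
      exact ⟨C, rfl, hs⟩

/-- Looking at both ends of a transition absorbs the extra step of IAT real time: transitions `0, …,
n` cover acceptance at all times up to `n + 1`. -/
theorem argsHit_iff (w : List A) (D : ℕ) :
    M.ArgsHit σ (IterArray.read 𝓝𝓝 (stream σ w) D) ↔ M.AcceptsAt w D ∨ M.AcceptsAt w (D + 1) := by
  rw [M.acceptsAt_iff σ, M.acceptsAt_iff σ]
  rfl

theorem HaltsAtWith.argsOut_eq_nil {w : List A} {t : ℕ} {v : List B} (h : M.HaltsAtWith w t v)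
    {D : ℕ} (hD : t ≤ D) : M.argsOut σ (IterArray.read 𝓝𝓝 (stream σ w) D) = [] := by
  obtain ⟨C, h1, h2, -⟩ := h
  have hnone : ∀ D, t < D → M.config w D = none := by
    intro D hD
    induction hD with
    | refl => rw [config, h1, Option.bind_some, step, h2]; rfl
    | step _ ih => rw [config, ih]; rfl
  rw [argsOut_read]
  rcases hD.eq_or_lt with rfl | hD
  · rcases M.config_spec σ w t with ⟨h3, -⟩ | ⟨C', h3, h4, -⟩
    · rw [h1] at h3
      cases h3
    · rw [h1] at h3
      cases h3
      rw [M.codedComm_read σ h4, h2]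
      rfl
  · rcases M.config_spec σ w D with ⟨-, h4⟩ | ⟨C', h3, -⟩
    · rw [h4]
      rfl
    · rw [hnone D hD] at h3
      cases h3

theorem HaltsAtWith.eq_outUntil {w : List A} {t : ℕ} {v : List B} (h : M.HaltsAtWith w t v)
    {t' : ℕ} (ht : t ≤ t') : v = M.outUntil σ w t' := by
  induction ht with
  | refl =>
    obtain ⟨C, h1, -, rfl⟩ := h
    rcases M.config_spec σ w t with ⟨h3, -⟩ | ⟨C', h3, -, h4⟩
    · rw [h1] at h3
      cases h3
    · rw [h1] at h3
      cases h3
      exact h4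
  | step hle ih =>
    rw [ih]
    simp only [outUntil, Nat.succ_eq_add_one, List.range_succ, List.map_append,
      List.flatten_append, List.map_cons, List.map_nil, List.flatten_singleton]
    rw [h.argsOut_eq_nil M σ hle, List.append_nil]

variable [Finite M.S] (k : ℕ) (flush : Prop)

instance : Finite (𝓝𝓝).V := inferInstanceAs (Finite (Option M.S))

/-- The cellular automaton transducer simulating an iterative array transducer. -/
noncomputable def toCAT : CAT A B :=
  IterArray.toCAT 𝓝𝓝 k (code σ) none (M.ArgsHit σ) (M.argsOut σ) flush

local notation "𝓜" => toCAT M σ k flush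

theorem accepts_of_toCAT_accepts {w : List A} (h : CAT.Accepts 𝓜 w) : M.Accepts w := by
  obtain ⟨D, hD⟩ := IterArray.hit_of_accepts _ _ _ _ _ _ _ h
  rcases (M.argsHit_iff σ w D).1 hD with h | h
  exacts [⟨_, h⟩, ⟨_, h⟩]

theorem toCAT_acceptsAt {w : List A} (hw : w ≠ []) {t : ℕ} (ht : t ≤ w.length + 1)
    (h : M.AcceptsAt w t) : CAT.AcceptsAt 𝓜 w w.length := by
  rcases t with _ | t
  · exact IterArray.acceptsAt_length _ _ _ _ _ _ _ (Nat.zero_le _) hw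
      ((M.argsHit_iff σ w 0).2 (Or.inl h))
  · exact IterArray.acceptsAt_length _ _ _ _ _ _ _ (show t ≤ _ by omega) hw
      ((M.argsHit_iff σ w t).2 (Or.inr h))

theorem toCAT_register {w : List A} {v : List B} {h : ℕ} (hh : M.HaltsAtWith w h v)
    (hflush : flush → h ≤ w.length + 1) (hk : h ≤ (k + 4) * w.length) {t : ℕ}
    {o : Fin w.length → List B} (ho : ∀ i, (CAT.config 𝓜 w t).out i = some (o i)) :
    (List.ofFn o).flatten = v := by
  have : o = fun i : Fin w.length => IterArray.blockOut 𝓝𝓝 k (M.argsOut σ) (stream σ w) i.val := by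
    funext i
    exact IterArray.register_eq _ _ _ _ _ _ _ (fun x => Option.some_ne_none _)
      (fun hf D hD => hh.argsOut_eq_nil M σ ((hflush hf).trans hD)) _ _ _ (ho i)
  rw [this, IterArray.flatten_blockOut]
  exact (hh.eq_outUntil M σ hk).symm

variable {M}

/-- The projection hypothesis makes every accepted input halt within the time bound, so all nonempty
outputs fit into the blocks; rejected inputs are rejected by the simulation too. -/
theorem toCAT_transduction {tout : ℕ → ℕ} (hproj : M.ProjectionIsAccepted)
    (htime : M.HasTime realTime tout) (hk : ∀ n, n ≠ 0 → tout n ≤ (k + 4) * n)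
    (hflush : flush → ∀ n, tout n ≤ n + 1) : CAT.transduction 𝓜 = M.transduction := by
  ext ⟨w, v⟩
  constructor
  · rintro ⟨hw, hacc, t, o, ho, hv⟩
    have : w ∈ Prod.fst '' M.transduction := by
      rw [hproj]
      exact ⟨hw, M.accepts_of_toCAT_accepts σ k flush hacc⟩
    obtain ⟨⟨w', v'⟩, hmem, hfst⟩ := this
    obtain rfl : w' = w := hfst
    obtain ⟨h, hle, hh⟩ := (htime _ _ hmem).2
    have := M.toCAT_register σ k flush hh (fun hf => hle.trans (hflush hf _))
      (hle.trans (hk _ (mt List.length_eq_zero_iff.1 hw))) ho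
    rw [this] at hv
    rwa [show v = v' from hv]
  · intro hmem
    obtain ⟨h, hle, hh⟩ := (htime _ _ hmem).2
    obtain ⟨t, ht, hacc⟩ := (htime _ _ hmem).1
    have hw : w ≠ [] := hmem.1
    have hc : CAT.CompleteAt 𝓜 w ((k + 3) * w.length) := IterArray.completeAt_mul _ _ _ _ _ _ _
    choose o ho using fun i => Option.ne_none_iff_exists'.1 (hc i)
    refine ⟨hw, ⟨_, M.toCAT_acceptsAt σ k flush hw ht hacc⟩, _, o, ho, ?_⟩
    exact (M.toCAT_register σ k flush hh (fun hf => hle.trans (hflush hf _))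
      (hle.trans (hk _ (mt List.length_eq_zero_iff.1 hw))) ho).symm

theorem mem_CATFamily {Γ : Type*} {A B : Finset Γ} {M : IAT A B} (hA : A.Nonempty)
    {tout tout' : ℕ → ℕ} (hproj : M.ProjectionIsAccepted)
    (htime : M.HasTime realTime tout) (k : ℕ) (flush : Prop)
    (hk : ∀ n, n ≠ 0 → tout n ≤ (k + 4) * n)
    (hflush : flush → ∀ n, tout n ≤ n + 1)
    (htout' : (flush ∧ ∀ n, n ≤ tout' n) ∨ ∀ n, (k + 3) * n ≤ tout' n) :
    Transduction.ofAlphabets M.transduction ∈ CATFamily Γ CAT.realTime tout' := by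
  have := M.finite_S
  -- States live in `Type` but `Γ` may lie in any universe, so symbols are coded by `Fin`.
  have σ : A ≃ Fin A.card := A.equivFin
  have heq := toCAT_transduction σ k flush hproj htime hk hflush
  refine ⟨A, B, M.toCAT σ k flush, hA, ?_, ?_, by rw [heq]⟩
  · rw [CAT.ProjectionIsAccepted, heq, hproj]
    ext w
    constructor
    · rintro ⟨hw, hacc⟩
      have : w ∈ Prod.fst '' M.transduction := by
        rw [hproj]
        exact ⟨hw, hacc⟩
      obtain ⟨p, hmem, rfl⟩ := this
      obtain ⟨t, ht, hacc⟩ := (htime _ _ hmem).1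
      exact ⟨hw, _, M.toCAT_acceptsAt σ k flush hw ht hacc⟩
    · exact fun h => ⟨h.1, M.accepts_of_toCAT_accepts σ k flush h.2⟩
  · intro w v hmem
    rw [heq] at hmem
    obtain ⟨t, ht, hacc⟩ := (htime _ _ hmem).1
    refine ⟨⟨_, le_rfl, M.toCAT_acceptsAt σ k flush hmem.1 ht hacc⟩, ?_⟩
    rcases htout' with ⟨hf, h⟩ | h
    · exact ⟨_, h _, IterArray.completeAt_length _ _ _ _ _ _ _ hf⟩
    · exact ⟨_, h _, IterArray.completeAt_mul _ _ _ _ _ _ _⟩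

end IAT

/-! ### The two inclusions. -/

/-- Only the CAT family demands a nonempty input alphabet; an IAT without input symbols yields just
the empty transduction, which is treated apart. -/
theorem Transduction.ofAlphabets_eq_empty {Γ : Type*} {A B : Finset Γ} (hA : ¬ A.Nonempty)
    {T : Set (List A × List B)} (hT : ∀ p ∈ T, p.1 ≠ []) :
    Transduction.ofAlphabets T = ∅ := by
  rw [Finset.not_nonempty_iff_eq_empty] at hA
  subst hA
  rw [Transduction.ofAlphabets, Set.image_eq_empty, Set.eq_empty_iff_forall_notMem]
  rintro ⟨_ | ⟨x, w⟩, v⟩ hp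
  · exact hT _ hp rfl
  · exact absurd x.2 (Finset.notMem_empty _)

theorem empty_mem_CATFamily {Γ : Type*} [Nonempty Γ] (tin tout : ℕ → ℕ) :
    (∅ : Transduction Γ) ∈ CATFamily Γ tin tout := by
  obtain ⟨x⟩ := ‹Nonempty Γ›
  let M : CAT ({x} : Finset Γ) (∅ : Finset Γ) :=
    { S := Unit
      finite_S := inferInstance
      F := ∅
      inp := ⟨fun _ => (), fun y z _ => Subsingleton.elim y z⟩
      δ := fun _ _ _ => ((), none) }
  have hacc : ∀ w, ¬ M.Accepts w := fun w ⟨t, i, _, h⟩ => h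
  have hT : M.transduction = ∅ :=
    Set.eq_empty_iff_forall_notMem.2 fun p hp => hacc _ hp.2.1
  refine ⟨{x}, ∅, M, Finset.singleton_nonempty x, ?_, ?_, ?_⟩
  · rw [CAT.ProjectionIsAccepted, hT, Set.image_empty, eq_comm, Set.eq_empty_iff_forall_notMem]
    exact fun w hw => hacc w hw.2
  · intro w v h
    rw [hT] at h
    exact h.elim
  · rw [hT, Transduction.ofAlphabets, Set.image_empty]

theorem linearTime_natCast (k n : ℕ) : linearTime k n = k * n := by
  rw [linearTime, ← Nat.cast_mul, Nat.floor_natCast]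

theorem linearTime_le_mul {k : ℚ} {K : ℕ} (h : k ≤ K) (n : ℕ) : linearTime k n ≤ K * n := by
  rw [← linearTime_natCast]
  exact Nat.floor_le_floor (mul_le_mul_of_nonneg_right h (Nat.cast_nonneg n))

theorem IATFamilyRtRt_subset (Γ : Type*) [Nonempty Γ] : IATFamilyRtRt Γ ⊆ CATFamilyRtRt Γ := by
  rintro _ ⟨A, B, M, hproj, htime, rfl⟩
  by_cases hA : A.Nonempty
  · refine IAT.mem_CATFamily hA hproj htime 0 True ?_ (fun _ _ => le_rfl)
      (Or.inl ⟨trivial, fun _ => le_rfl⟩)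
    intro n hn
    rw [IAT.realTime]
    omega
  · rw [Transduction.ofAlphabets_eq_empty hA fun p hp => hp.1]
    exact empty_mem_CATFamily _ _

theorem IATFamilyRtLt_subset (Γ : Type*) [Nonempty Γ] : IATFamilyRtLt Γ ⊆ CATFamilyRtLt Γ := by
  rintro _ ⟨c, hc, A, B, M, hproj, htime, rfl⟩
  by_cases hA : A.Nonempty
  · refine ⟨((⌈c⌉₊ + 3 : ℕ) : ℚ), by exact_mod_cast (by omega : 1 ≤ ⌈c⌉₊ + 3),
      IAT.mem_CATFamily hA hproj htime ⌈c⌉₊ False (fun n _ => ?_) False.elim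
        (Or.inr fun n => (linearTime_natCast _ n).ge)⟩
    exact (linearTime_le_mul (Nat.le_ceil c) n).trans (Nat.mul_le_mul_right n (by omega))
  · rw [Transduction.ofAlphabets_eq_empty hA fun p hp => hp.1]
    exact ⟨1, le_rfl, empty_mem_CATFamily _ _⟩

/-! ### The separating language and its real-time recognition. -/

/-- The separator `2` occurs in `l`, and the longest separator-free prefixes of `l` and of its
reversal agree. -/
def EndsMatch (l : List (Fin 3)) : Prop :=
  2 ∈ l ∧ l.takeWhile (· ≠ 2) = l.reverse.takeWhile (· ≠ 2)

/-- Some suffix of the word consists of a separator and a word whose ends match. -/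
def HasMatch : List (Fin 3) → Prop
  | [] => False
  | a :: l => HasMatch l ∨ a = 2 ∧ EndsMatch l

theorem not_endsMatch {l : List (Fin 3)} (h : 2 ∉ l) : ¬ EndsMatch l := fun h' => h h'.1

theorem endsMatch_singleton (a : Fin 3) : EndsMatch [a] ↔ a = 2 := by
  simp only [EndsMatch, List.mem_singleton, List.reverse_singleton, and_true]
  exact eq_comm

theorem takeWhile_append_of_mem {α : Type*} {p : α → Bool} {l l' : List α} {b : α} (hb : b ∈ l)
    (hpb : p b = false) : (l ++ l').takeWhile p = l.takeWhile p := by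
  induction l with
  | nil => simp at hb
  | cons a l ih =>
    rw [List.cons_append, List.takeWhile_cons, List.takeWhile_cons]
    rcases List.mem_cons.1 hb with rfl | hb
    · simp [hpb]
    · rw [ih hb]

/-- Comparing the end blocks letter by letter from outside: the comparison succeeds when both
separators are met simultaneously. -/
theorem endsMatch_cons_concat (a b : Fin 3) (l : List (Fin 3)) :
    EndsMatch (a :: (l ++ [b])) ↔ (a = 2 ∧ b = 2) ∨ (a = b ∧ a ≠ 2 ∧ EndsMatch l) := by
  have hrev : (a :: (l ++ [b])).reverse = b :: (l.reverse ++ [a]) := by simp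
  rw [EndsMatch, hrev, List.takeWhile_cons, List.takeWhile_cons]
  by_cases ha : a = 2 <;> by_cases hb : b = 2
  · simp [ha, hb]
  · simp [ha, hb]
  · simp [ha, hb]
  · have ha' : ¬ 2 = a := fun h => ha h.symm
    have hb' : ¬ 2 = b := fun h => hb h.symm
    by_cases hl : 2 ∈ l
    · rw [takeWhile_append_of_mem hl (by simp), takeWhile_append_of_mem (List.mem_reverse.2 hl)
        (by simp)]
      simp [ha, hb, hl, EndsMatch]
    · simp [ha, ha', hb', hl, EndsMatch]

/-- The states of a cellular automaton deciding `HasMatch`. -/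
@[ext]
structure MatchState where
  first : Fin 3
  next : Option (Fin 3)
  cur : Prop
  prev : Prop
  found : Prop

instance : Finite MatchState :=
  Finite.of_injective (fun s : MatchState => (s.first, s.next, s.cur, s.prev, s.found))
    fun s s' h => by
      simp only [Prod.mk.injEq] at h
      exact MatchState.ext h.1 h.2.1 h.2.2.1 h.2.2.2.1 h.2.2.2.2

/-- The local transition function of a cellular automaton deciding `HasMatch`. -/
def MatchState.step (c : MatchState) (r : Option MatchState) : MatchState :=
  match c.next with
  -- The right end of the input has been passed, so the verdict is frozen.
  | none => { c with next := r.bind MatchState.next }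
  | some b =>
    { first := c.first
      next := r.bind MatchState.next
      cur := (c.first = 2 ∧ b = 2) ∨ (c.first = b ∧ c.first ≠ 2 ∧ ∃ s, r = some s ∧ s.prev)
      prev := c.cur
      found := ∃ s, r = some s ∧ (s.found ∨ c.first = 2 ∧ s.cur) }

/-- The cellular automaton transducer mapping the words with a match to the empty word. -/
def matchCAT {A : Type*} (B : Type*) (σ : A ↪ Fin 3) : CAT A B where
  S := MatchState
  finite_S := inferInstance
  F := {s | s.next = none ∧ s.found}
  inp := ⟨fun x => ⟨σ x, some (σ x), False, False, False⟩, fun _ _ h =>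
    σ.injective (congrArg MatchState.first h)⟩
  δ _ c r := (c.step r, some [])

namespace MatchState

/-- The state `c` is the correct state of cell `x` at time `t` on input `w`. -/
structure IsCell (w : List (Fin 3)) (t x : ℕ) (c : MatchState) : Prop where
  first : w[x]? = some c.first
  cur : c.cur ↔ EndsMatch ((w.drop x).take t)
  prev : c.prev ↔ EndsMatch ((w.drop x).take (t - 1))
  found : c.found ↔ HasMatch ((w.drop x).take t)

/-- Cell `x` at time `t` knows the subword of length `t` from `x`. For length `t + 1`, `EndsMatch`
needs the inner word, of length `t - 1` from `x + 1`, which is why neighbours remember `prev`;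
`HasMatch` needs the word of length `t` from `x + 1`. -/
theorem IsCell.step {w : List (Fin 3)} {t x : ℕ} {c : MatchState} (hc : IsCell w t x c)
    (hnext : c.next = w[x + t]?) (hx : x + t < w.length) {r : Option MatchState}
    (hr : (x + 1 = w.length ∧ r = none) ∨ ∃ s, r = some s ∧ IsCell w t (x + 1) s) :
    IsCell w (t + 1) x (c.step r) := by
  have hx' : x < w.length := by omega
  have hfirst : w[x] = c.first := by
    rw [← Option.some_inj, ← hc.first, List.getElem?_eq_getElem hx']
  rw [List.getElem?_eq_getElem hx] at hnext
  have hcons : (w.drop x).take (t + 1) = c.first :: (w.drop (x + 1)).take t := by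
    rw [List.drop_eq_getElem_cons hx', List.take_succ_cons, hfirst]
  unfold MatchState.step
  rw [hnext]
  refine ⟨hc.first, ?_, ?_, ?_⟩
  · rw [hcons]
    -- At `t = 0` first and last letter coincide; the truncated `t - 1` makes the neighbour's `prev`
    -- refer to the empty word, so it is false.
    rcases t with _ | t
    · have hsing : (w.drop (x + 1)).take 0 = [] := rfl
      have he : w[x + 0] = c.first := hfirst
      rw [hsing, endsMatch_singleton]
      simp only [he]
      constructor
      · rintro (⟨h, -⟩ | ⟨-, -, s, hs, h⟩)
        · exact h
        · rcases hr with ⟨-, rfl⟩ | ⟨s', rfl, hs'⟩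
          · cases hs
          · cases hs
            rw [hs'.prev] at h
            exact absurd h (not_endsMatch (by simp))
      · exact fun h => Or.inl ⟨h, h⟩
    · have hl : t < (w.drop (x + 1)).length := by rw [List.length_drop]; omega
      have hlast : (w.drop (x + 1)).take (t + 1) =
          (w.drop (x + 1)).take t ++ [w[x + (t + 1)]] := by
        rw [List.take_succ_eq_append_getElem hl, List.getElem_drop]
        simp only [add_assoc, add_comm 1 t]
      rw [hlast, endsMatch_cons_concat]
      rcases hr with ⟨h, -⟩ | ⟨s', rfl, hs'⟩
      · omega
      · have := hs'.prev
        rw [Nat.add_sub_cancel] at this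
        simp [this]
  · exact hc.cur
  · rw [hcons, HasMatch]
    rcases hr with ⟨h, rfl⟩ | ⟨s', rfl, hs'⟩
    · have : (w.drop (x + 1)).take t = [] := by
        rw [List.drop_eq_nil_of_le h.ge, List.take_nil]
      rw [this]
      simp [HasMatch, EndsMatch]
    · simp [hs'.found, hs'.cur]

end MatchState

section

variable {A B : Type*} (σ : A ↪ Fin 3) (w : List A)

local notation "𝓜" => matchCAT B σ

theorem matchCAT_next (t : ℕ) (i : Fin w.length) :
    MatchState.next ((CAT.config 𝓜 w t).state i) = (w.map σ)[i.val + t]? := by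
  induction t generalizing i with
  | zero =>
    change some (σ (w.get i)) = _
    simp
  | succ t ih =>
    rw [CAT.state_succ]
    have key : ∀ (c : MatchState) r, (c.step r).next = r.bind MatchState.next := by
      intro c r
      unfold MatchState.step
      split <;> rfl
    refine (key _ _).trans ?_
    unfold CAT.rightOf
    split_ifs with h
    · exact (ih _).trans (by simp only [add_assoc, add_comm 1 t])
    · rw [List.getElem?_eq_none (by rw [List.length_map]; omega)]
      rfl

theorem matchCAT_isCell (t : ℕ) (i : Fin w.length) (hi : i.val + t ≤ w.length) :
    MatchState.IsCell (w.map σ) t i.val ((CAT.config 𝓜 w t).state i) := by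
  induction t generalizing i with
  | zero =>
    have h : ∀ P : Prop, ¬ P → (False ↔ P) := fun P hP => ⟨False.elim, hP⟩
    refine ⟨?_, h _ (not_endsMatch (by simp)), h _ (not_endsMatch (by simp)), h _ (by simp [HasMatch])⟩
    change _ = some (σ (w.get i))
    simp
  | succ t ih =>
    rw [CAT.state_succ]
    refine (ih i (by omega)).step (matchCAT_next σ w t i) (by rw [List.length_map]; omega) ?_
    by_cases h : i.val + 1 < w.length
    · exact Or.inr ⟨_, dif_pos h, ih ⟨i.val + 1, h⟩ (by simp only; omega)⟩
    · exact Or.inl ⟨by rw [List.length_map]; omega, dif_neg h⟩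

theorem matchCAT_found (hw : 0 < w.length) {t : ℕ} (ht : w.length ≤ t) :
    MatchState.found ((CAT.config 𝓜 w t).state ⟨0, hw⟩) ↔ HasMatch (w.map σ) := by
  induction ht with
  | refl =>
    rw [(matchCAT_isCell σ w w.length ⟨0, hw⟩ (by simp)).found, List.drop_zero,
      List.take_of_length_le (by rw [List.length_map])]
  | @step t hle ih =>
    rw [← ih, CAT.state_succ]
    change MatchState.found (MatchState.step _ _) ↔ _
    have hn := matchCAT_next (B := B) σ w t ⟨0, hw⟩
    rw [List.getElem?_eq_none (by rw [List.length_map]; simpa using hle)] at hn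
    unfold MatchState.step
    rw [hn]

theorem matchCAT_acceptsAt_iff (t : ℕ) :
    CAT.AcceptsAt 𝓜 w t ↔ w ≠ [] ∧ w.length ≤ t ∧ HasMatch (w.map σ) := by
  constructor
  · rintro ⟨⟨_, hw⟩, rfl, h1, h2⟩
    rw [matchCAT_next, List.getElem?_eq_none_iff, List.length_map] at h1
    simp only [zero_add] at h1
    exact ⟨List.ne_nil_of_length_pos hw, h1, (matchCAT_found σ w hw h1).1 h2⟩
  · rintro ⟨hw, ht, h⟩
    have hw' := List.length_pos_of_ne_nil hw
    refine ⟨⟨0, hw'⟩, rfl, ?_, (matchCAT_found σ w hw' ht).2 h⟩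
    rw [matchCAT_next, List.getElem?_eq_none_iff, List.length_map]
    simpa using ht

theorem matchCAT_accepts_iff : CAT.Accepts 𝓜 w ↔ w ≠ [] ∧ HasMatch (w.map σ) := by
  simp only [CAT.Accepts, matchCAT_acceptsAt_iff]
  exact ⟨fun ⟨_, h, _, h'⟩ => ⟨h, h'⟩, fun ⟨h, h'⟩ => ⟨_, h, le_rfl, h'⟩⟩

theorem matchCAT_out (t : ℕ) (i : Fin w.length) :
    (CAT.config 𝓜 w (t + 1)).out i = some [] := by
  induction t with
  | zero => exact CAT.out_succ_of_none _ rfl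
  | succ t ih => exact CAT.out_succ_of_some _ ih

theorem matchCAT_transduction : CAT.transduction 𝓜 =
    {p | p.1 ≠ [] ∧ HasMatch (p.1.map σ) ∧ p.2 = []} := by
  ext ⟨w, v⟩
  constructor
  · rintro ⟨hw, hacc, t, o, ho, hv⟩
    refine ⟨hw, ((matchCAT_accepts_iff σ w).1 hacc).2, ?_⟩
    have hnil : ∀ i, o i = [] := fun i => by
      have h := ho i
      rcases t with _ | t
      · cases h
      · rw [matchCAT_out] at h
        exact (Option.some.inj h).symm
    rw [hv, List.flatten_eq_nil_iff]
    intro l hl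
    obtain ⟨i, rfl⟩ := (List.mem_ofFn' o l).1 hl
    exact hnil i
  · rintro ⟨hw, hmatch, rfl⟩
    refine ⟨hw, (matchCAT_accepts_iff σ w).2 ⟨hw, hmatch⟩, 1, fun _ => [],
      matchCAT_out σ w 0, ?_⟩
    simp

end

theorem matchCAT_mem {Γ : Type*} {A B : Finset Γ} (hA : A.Nonempty) (σ : A ↪ Fin 3)
    {tout : ℕ → ℕ} (htout : ∀ n, n ≤ tout n) :
    Transduction.ofAlphabets (CAT.transduction (matchCAT B σ)) ∈
      CATFamily Γ CAT.realTime tout := by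
  refine ⟨A, B, matchCAT B σ, hA, ?_, ?_, rfl⟩
  · rw [CAT.ProjectionIsAccepted, matchCAT_transduction]
    ext w
    rw [Set.mem_ofPred_eq, matchCAT_accepts_iff]
    constructor
    · rintro ⟨p, ⟨h1, h2, -⟩, rfl⟩
      exact ⟨h1, h1, h2⟩
    · rintro ⟨h1, -, h2⟩
      exact ⟨(w, []), ⟨h1, h2, rfl⟩, rfl⟩
  · intro w v h
    rw [matchCAT_transduction] at h
    have hw : w ≠ [] := h.1
    have hpos := List.length_pos_of_ne_nil hw
    refine ⟨⟨_, le_rfl, (matchCAT_acceptsAt_iff σ w _).2 ⟨hw, le_rfl, h.2.1⟩⟩,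
      1, le_trans hpos (htout _), fun i => ?_⟩
    rw [matchCAT_out]
    exact Option.some_ne_none _

/-! ### The lower bound for real-time iterative arrays. -/

theorem takeWhile_append_cons_of_not_mem {x l : List (Fin 3)} (hx : 2 ∉ x) :
    (x ++ 2 :: l).takeWhile (· ≠ 2) = x := by
  rw [List.takeWhile_append_of_pos, List.takeWhile_cons_of_neg (by simp), List.append_nil]
  intro a ha
  simp only [ne_eq, decide_not, Bool.not_eq_eq_eq_not, Bool.not_true, decide_eq_false_iff_not]
  rintro rfl
  exact hx ha

theorem hasMatch_append {x l : List (Fin 3)} (hx : 2 ∉ x) : HasMatch (x ++ l) ↔ HasMatch l := by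
  induction x with
  | nil => rfl
  | cons a x ih =>
    rw [List.mem_cons, not_or] at hx
    rw [List.cons_append, HasMatch, ih hx.2]
    simp [Ne.symm hx.1]

/-- A list of words, written with separators. -/
def blockWord (bl : List (List (Fin 3))) : List (Fin 3) := bl.flatMap (2 :: ·) ++ [2]

/-- The prefix encodes a set of words and `y` is a membership query: a suffix starting at a
separator compares its first block with the reversal of `y`, and the last such suffix has no further
separator. -/
theorem hasMatch_blockWord_append {bl : List (List (Fin 3))} (hbl : ∀ x ∈ bl, 2 ∉ x)
    {y : List (Fin 3)} (hy : 2 ∉ y) : HasMatch (blockWord bl ++ y) ↔ y.reverse ∈ bl := by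
  have hy' : 2 ∉ y.reverse := by rwa [List.mem_reverse]
  induction bl with
  | nil =>
    have h : HasMatch y ↔ HasMatch [] := by
      conv_lhs => rw [← List.append_nil y]
      exact hasMatch_append hy
    simp [blockWord, HasMatch, h, not_endsMatch hy]
  | cons x bl ih =>
    have hx : 2 ∉ x := hbl x List.mem_cons_self
    have hcons : blockWord (x :: bl) ++ y = 2 :: (x ++ (blockWord bl ++ y)) := by
      simp [blockWord]
    obtain ⟨l, hl⟩ : ∃ l, blockWord bl ++ y = 2 :: l := by
      rcases bl with _ | ⟨x', bl⟩ <;> simp [blockWord]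
    have hrev : (x ++ (blockWord bl ++ y)).reverse =
        y.reverse ++ 2 :: ((bl.flatMap (2 :: ·)).reverse ++ x.reverse) := by
      simp [blockWord]
    have hmem : 2 ∈ x ++ (blockWord bl ++ y) := by simp [blockWord]
    have ih' : HasMatch (blockWord bl ++ y) ↔ y.reverse ∈ bl :=
      ih fun x hx => hbl x (List.mem_cons_of_mem _ hx)
    rw [hcons, HasMatch, hasMatch_append hx, ih',
      EndsMatch, hrev, takeWhile_append_cons_of_not_mem hy', hl,
      takeWhile_append_cons_of_not_mem hx, ← hl, List.mem_cons]
    simp only [hmem, true_and]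
    rw [or_comm, eq_comm]

namespace IterArray

variable {α : Type} (N : IterArray α)

theorem diag_congr {a a' : ℕ → α} {t : ℕ} (h : ∀ i < t, a i = a' i) (j : ℕ) :
    N.diag a t j = N.diag a' t j := by
  induction t generalizing j with
  | zero => rfl
  | succ t ih =>
    have ih' := ih fun i hi => h i (by omega)
    rcases j with _ | j
    · rw [diag, diag, ih', ih', h t (by omega)]
    · rw [diag, diag, ih', ih', ih']

/-- Light cone: after `k` steps, cell `j` depends only on the cells up to `j + k` and the symbols
read meanwhile. -/
theorem diag_add_congr {a a' : ℕ → α} {t t' n : ℕ} (ha : ∀ i, a (t + i) = a' (t' + i))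
    (h : ∀ j ≤ n, N.diag a t j = N.diag a' t' j) (k j : ℕ) (hjk : j + k ≤ n) :
    N.diag a (t + k) j = N.diag a' (t' + k) j := by
  induction k generalizing j with
  | zero => exact h j (by omega)
  | succ k ih =>
    rw [← add_assoc, ← add_assoc]
    rcases j with _ | j
    · rw [diag, diag, ih 0 (by omega), ih 1 (by omega), ha]
    · rw [diag, diag, ih j (by omega), ih (j + 1) (by omega), ih (j + 2) (by omega)]

end IterArray

/-- A binary word. -/
def binaryWord {n : ℕ} (f : Fin n → Bool) : List (Fin 3) :=
  List.ofFn fun i => if f i then 1 else 0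

theorem binaryWord_injective {n : ℕ} : Function.Injective (binaryWord (n := n)) := by
  intro f g h
  have := List.ofFn_injective h
  funext i
  have hi := congrFun this i
  rcases hf : f i <;> rcases hg : g i <;> simp [hf, hg] at hi ⊢

theorem two_notMem_binaryWord {n : ℕ} (f : Fin n → Bool) : 2 ∉ binaryWord f := by
  rw [binaryWord, List.mem_ofFn']
  rintro ⟨i, hi⟩
  rcases hf : f i <;> simp [hf] at hi

theorem exists_mul_pow_lt (s : ℕ) : ∃ m, 2 * s ^ (m + 2) < 2 ^ 2 ^ m := by
  have h : ∀ s : ℕ, 2 * (s + 3) ≤ 2 ^ (s + 3) := by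
    intro s
    induction s with
    | zero => norm_num
    | succ s ih =>
      rw [show s + 1 + 3 = s + 3 + 1 by ring, pow_succ]
      omega
  -- Then `2 ^ m` is the square of `2 ^ (s + 3)`, which beats the quadratic exponent `1 + s * (m +
  -- 2)`.
  refine ⟨2 * (s + 3), ?_⟩
  have h1 : 1 + s * (2 * (s + 3) + 2) < 2 ^ (2 * (s + 3)) := by
    rw [mul_comm 2 (s + 3), pow_mul]
    nlinarith [h s]
  calc 2 * s ^ (2 * (s + 3) + 2) ≤ 2 * (2 ^ s) ^ (2 * (s + 3) + 2) :=
        Nat.mul_le_mul_left _ (Nat.pow_le_pow_left Nat.lt_two_pow_self.le _)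
    _ = 2 ^ (1 + s * (2 * (s + 3) + 2)) := by rw [← pow_mul, pow_add, pow_one]
    _ < 2 ^ 2 ^ (2 * (s + 3)) := Nat.pow_lt_pow_right one_lt_two h1

namespace IAT

/-- The language of the words with a match is not accepted by an iterative array in real time. -/
theorem not_forall_accepts_iff_hasMatch {A B : Type*} (M : IAT A B) {c : ℕ} (σ : A ≃ Fin c)
    (ι : Fin 3 → A)
    (h : ∀ w : List (Fin 3), w ≠ [] → (HasMatch w ↔
      ∃ t ≤ w.length + 1, M.AcceptsAt (w.map ι) t)) : False := by
  have := M.finite_S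
  let N := M.toIterArray σ
  have : Finite N.V := inferInstanceAs (Finite (Option M.S))
  obtain ⟨m, hm⟩ := exists_mul_pow_lt (Nat.card N.V)
  let u (X : Finset (Fin m → Bool)) : List (Fin 3) := blockWord (X.toList.map binaryWord)
  -- Acceptance at any time counts, so the class of a prefix also records whether it has already
  -- occurred. The remaining `m + 1` steps let the communication cell depend on cells `0, …, m + 1`
  -- only.
  let cls (X : Finset (Fin m → Bool)) : Prop × (Fin (m + 2) → N.V) :=
    (∃ t ≤ (u X).length, M.AcceptsAt ((u X).map ι) t,
      fun j => N.diag (stream σ ((u X).map ι)) (u X).length j)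
  have hpre : ∀ (X : Finset (Fin m → Bool)) (y : List (Fin 3)) (t : ℕ), t ≤ (u X).length →
      ∀ j, N.diag (stream σ ((u X ++ y).map ι)) t j = N.diag (stream σ ((u X).map ι)) t j := by
    intro X y t ht j
    refine N.diag_congr (fun i hi => ?_) j
    rw [stream, stream, List.codeStream, List.codeStream, List.map_append,
      List.getElem?_append_left (by rw [List.length_map]; omega)]
  have hsuf : ∀ (X : Finset (Fin m → Bool)) (y : List (Fin 3)) (i : ℕ),
      stream σ ((u X ++ y).map ι) ((u X).length + i) = stream σ (y.map ι) i := by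
    intro X y i
    rw [stream, stream, List.codeStream, List.codeStream, List.map_append,
      List.getElem?_append_right (by rw [List.length_map]; omega), List.length_map,
      Nat.add_sub_cancel_left]
  have hmem : ∀ X f, f ∈ X ↔ (∃ t ≤ (u X).length, M.AcceptsAt ((u X).map ι) t) ∨
      ∃ i ≤ m + 1, M.AcceptsAt ((u X ++ (binaryWord f).reverse).map ι) ((u X).length + i) := by
    intro X f
    have h1 : HasMatch (u X ++ (binaryWord f).reverse) ↔ f ∈ X := by
      rw [hasMatch_blockWord_append, List.reverse_reverse,
        List.mem_map_of_injective binaryWord_injective, Finset.mem_toList]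
      · intro x hx
        obtain ⟨g, -, rfl⟩ := List.mem_map.1 hx
        exact two_notMem_binaryWord g
      · rw [List.mem_reverse]
        exact two_notMem_binaryWord f
    have hlen : (u X ++ (binaryWord f).reverse).length = (u X).length + m := by
      simp [binaryWord]
    rw [← h1, h _ (by simp [u, blockWord]), hlen]
    have hearly : ∀ t ≤ (u X).length, (M.AcceptsAt ((u X).map ι) t ↔
        M.AcceptsAt ((u X ++ (binaryWord f).reverse).map ι) t) := by
      intro t ht
      rw [M.acceptsAt_iff σ, M.acceptsAt_iff σ]
      have := hpre X (binaryWord f).reverse t ht 0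
      rw [show IterArray.diag (toIterArray M σ) _ t 0 = _ from this]
    constructor
    · rintro ⟨t, ht, hacc⟩
      rcases le_total t (u X).length with htu | htu
      · exact Or.inl ⟨t, htu, (hearly t htu).2 hacc⟩
      · obtain ⟨i, rfl⟩ := Nat.exists_eq_add_of_le htu
        exact Or.inr ⟨i, by omega, hacc⟩
    · rintro (⟨t, ht, hacc⟩ | ⟨i, hi, hacc⟩)
      · exact ⟨t, by omega, (hearly t ht).1 hacc⟩
      · exact ⟨_, by omega, hacc⟩
  have hinj : Function.Injective cls := by
    intro X X' hcls
    obtain ⟨h1, h2⟩ := Prod.mk.inj hcls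
    ext f
    rw [hmem, hmem, h1]
    refine or_congr Iff.rfl (exists_congr fun i => and_congr_right fun hi => ?_)
    rw [M.acceptsAt_iff σ, M.acceptsAt_iff σ]
    have key : N.diag (stream σ ((u X ++ (binaryWord f).reverse).map ι)) ((u X).length + i) 0 =
        N.diag (stream σ ((u X' ++ (binaryWord f).reverse).map ι)) ((u X').length + i) 0 := by
      refine N.diag_add_congr (n := m + 1) (fun i => by rw [hsuf, hsuf]) (fun j hj => ?_) i 0
        (by omega)
      rw [hpre _ _ _ le_rfl, hpre _ _ _ le_rfl]
      exact congrFun h2 ⟨j, by omega⟩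
    rw [show IterArray.diag (toIterArray M σ) _ ((u X).length + i) 0 = _ from key]
  have hcard := Nat.card_le_card_of_injective cls hinj
  rw [Nat.card_prod, Nat.card_fun, Nat.card_eq_fintype_card (α := Finset (Fin m → Bool)),
    Fintype.card_finset, Fintype.card_fun, Fintype.card_bool, Fintype.card_fin,
    Nat.card_eq_fintype_card (α := Prop), Fintype.card_prop, Nat.card_eq_fintype_card (α := Fin _),
    Fintype.card_fin] at hcard
  omega

end IAT

/-! ### The separating transduction and the conclusion. -/

/-- The alphabet of the separating transduction. -/
noncomputable def matchAlphabet {Γ : Type*} (e : Fin 3 ↪ Γ) : Finset Γ := Finset.univ.map e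

/-- The letters of the alphabet of the separating transduction. -/
noncomputable def matchEquiv {Γ : Type*} (e : Fin 3 ↪ Γ) : matchAlphabet e ≃ Fin 3 :=
  (Equiv.ofBijective (fun x => ⟨e x, Finset.mem_map_of_mem e (Finset.mem_univ x)⟩)
    ⟨fun _ _ h => e.injective (congrArg Subtype.val h), fun y => by
      obtain ⟨x, -, hx⟩ := Finset.mem_map.1 y.2
      exact ⟨x, Subtype.ext hx⟩⟩).symm

theorem matchEquiv_symm_val {Γ : Type*} (e : Fin 3 ↪ Γ) (x : Fin 3) :
    ((matchEquiv e).symm x).val = e x := rfl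

/-- The transduction mapping the words with a match to the empty word. -/
noncomputable def matchTransduction {Γ : Type*} (e : Fin 3 ↪ Γ) : Transduction Γ :=
  Transduction.ofAlphabets
    (CAT.transduction (matchCAT (∅ : Finset Γ) (matchEquiv e).toEmbedding))

theorem mem_image_matchTransduction {Γ : Type*} (e : Fin 3 ↪ Γ) (w : List (Fin 3)) :
    w.map e ∈ Prod.fst '' matchTransduction e ↔ w ≠ [] ∧ HasMatch w := by
  rw [matchTransduction, matchCAT_transduction, Transduction.ofAlphabets]
  constructor
  · rintro ⟨_, ⟨⟨w', v⟩, ⟨hw, hmatch, -⟩, rfl⟩, heq⟩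
    have : w'.map (matchEquiv e) = w := by
      apply List.map_injective_iff.2 e.injective
      rw [← heq, List.map_map]
      refine List.map_congr_left fun x _ => ?_
      rw [Function.comp_apply, ← matchEquiv_symm_val, Equiv.symm_apply_apply]
    subst this
    exact ⟨by simpa using hw, hmatch⟩
  · rintro ⟨hw, hmatch⟩
    refine ⟨_, ⟨(w.map (matchEquiv e).symm, []), ⟨by simpa using hw, ?_, rfl⟩, rfl⟩, ?_⟩
    · simpa using hmatch
    · simp only [List.map_map]
      exact List.map_congr_left fun x _ => matchEquiv_symm_val e x

/-- The obstruction concerns the accepted inputs alone, hence any output time bound is allowed. -/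
theorem matchTransduction_notMem {Γ : Type*} (e : Fin 3 ↪ Γ) (tout : ℕ → ℕ) :
    matchTransduction e ∉ IATFamily Γ IAT.realTime tout := by
  rintro ⟨A, B, M, hproj, htime, heq⟩
  have hmem : ∀ w : List (Fin 3), w ≠ [] ∧ HasMatch w ↔
      ∃ w' : List A, w' ≠ [] ∧ M.Accepts w' ∧ w'.map Subtype.val = w.map e := by
    intro w
    rw [← mem_image_matchTransduction, heq, Transduction.ofAlphabets, Set.image_image]
    constructor
    · rintro ⟨p, hp, h⟩
      exact ⟨p.1, hp.1, hp.2.1, h⟩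
    · rintro ⟨w', hw', hacc, h⟩
      have : w' ∈ Prod.fst '' M.transduction := by
        rw [hproj]
        exact ⟨hw', hacc⟩
      obtain ⟨p, hp, rfl⟩ := this
      exact ⟨p, hp, h⟩
  have hletters : ∀ x, e x ∈ A := by
    -- The alphabet of the IAT is unknown; one word with a match using all three letters forces them
    -- into it.
    have hword : HasMatch [2, 0, 1, 2, 1, 0] := by simp [HasMatch, EndsMatch]
    obtain ⟨w', -, -, h⟩ := (hmem [2, 0, 1, 2, 1, 0]).1 ⟨by simp, hword⟩
    intro x
    have hx : e x ∈ List.map e [2, 0, 1, 2, 1, 0] :=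
      List.mem_map_of_mem (by fin_cases x <;> simp)
    rw [← h] at hx
    obtain ⟨y, -, hy⟩ := List.mem_map.1 hx
    rw [← hy]
    exact y.2
  refine M.not_forall_accepts_iff_hasMatch A.equivFin (fun x => ⟨e x, hletters x⟩) fun w hw => ?_
  have hw' : w.map (fun x => (⟨e x, hletters x⟩ : A)) ≠ [] := by simpa using hw
  have hmap : (w.map fun x => (⟨e x, hletters x⟩ : A)).map Subtype.val = w.map e := by
    rw [List.map_map]
    rfl
  constructor
  · intro h
    obtain ⟨w', -, hacc, h'⟩ := (hmem w).1 ⟨hw, h⟩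
    rw [← hmap] at h'
    obtain rfl := List.map_injective_iff.2 Subtype.val_injective h'
    have : w.map (fun x => (⟨e x, hletters x⟩ : A)) ∈ Prod.fst '' M.transduction := by
      rw [hproj]
      exact ⟨hw', hacc⟩
    obtain ⟨⟨w', v⟩, hp, rfl⟩ := this
    have := (htime _ _ hp).1
    rwa [List.length_map] at this
  · rintro ⟨t, -, hacc⟩
    exact ((hmem w).2 ⟨_, hw', ⟨t, hacc⟩, hmap⟩).2

theorem mainTheorem2 (Γ : Type*) [Infinite Γ] :
    IATFamilyRtRt Γ ⊂ CATFamilyRtRt Γ ∧ IATFamilyRtLt Γ ⊂ CATFamilyRtLt Γ := by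
  obtain ⟨e⟩ : Nonempty (Fin 3 ↪ Γ) := ⟨Fin.valEmbedding.trans (Infinite.natEmbedding Γ)⟩
  have hA : (matchAlphabet e).Nonempty := Finset.univ_nonempty.map
  refine ⟨⟨IATFamilyRtRt_subset Γ, fun h => ?_⟩, ⟨IATFamilyRtLt_subset Γ, fun h => ?_⟩⟩
  · exact matchTransduction_notMem e _ (h (matchCAT_mem hA _ fun _ => le_rfl))
  · obtain ⟨k, -, hk⟩ := h ⟨1, le_rfl, matchCAT_mem hA _ fun n => by
      rw [← Nat.cast_one, linearTime_natCast, one_mul]⟩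
    exact matchTransduction_notMem e _ hk
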